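/- Let $M$ be a Hausdorff smooth (finite-dimensional, real) manifold with tangent bundle $T$ and cotangent bundle $T^*$. Put $(X+\xi,Y+\eta)=\tfrac12(\xi(Y)+\eta(X))$ on $T\oplus T^*$, and let $$[X+\xi,Y+\eta]=[X,Y]+L_X\eta-L_Y\xi-\tfrac12 d(\iota_X\eta-\iota_Y\xi)$$ be the Courant bracket. A generalized complex structure on $M$ is a smooth bundle endomorphism $\mathbb J$ of $T\oplus T^*$ with $\mathbb J^2=-1$ and $(\mathbb J\cdot,\cdot)=-(\cdot,\mathbb J\cdot)$, such that the spaces of smooth sections of its two eigenspaces $\ker(\mathbb J\mp i)\subset (T\oplus T^*)\otimes\mathbb C$ are closed under the (complex bilinearly extended) Courant bracket. Every such $\mathbb J$ has the form $$\mathbb J=\begin{pmatrix}A&\pi_A\\ \sigma&-A^*\end{pmatrix},\qquad A:T\to T,\quad \pi_A:T^*\to T,\quad \sigma:T\to T^*.$$ A smooth bivector is identified with the corresponding skew bundle map $T^*\to T$, and it is called non-degenerate if this map is an isomorphism; likewise for the $2$-form $\sigma:T\to T^*$. A Hitchin pair of bivectors is a pair $(\pi,\Pi)$ of smooth bivectors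 on $M$, with $\Pi$ non-degenerate, such that, for the Schouten bracket, $$[\Pi,\Pi]=[\pi,\pi],\qquad [\Pi,\pi]=0.$$ Then there is a bijection between the set of generalized complex structures $\mathbb J$ on $M$ whose block $\sigma$ is non-degenerate and the set of Hitchin pairs of bivectors $(\pi,\Pi)$ on $M$, under which $$\sigma=\Pi^{-1},\qquad A=\pi\circ\Pi^{-1},\qquad \pi_A=-(1+A^2)\circ\Pi .$$ -/

import Mathlib

open scoped Manifold ContDiff

noncomputable section

namespace GenComplex

section Fibres

variable (E : Type*) [NormedAddCommGroup E] [NormedSpace ℝ E]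
  {M : Type*} [TopologicalSpace M] [ChartedSpace E M]

/-- The tangent space `T_x M` of a manifold `M` modelled on `E`. -/
abbrev Tan (x : M) : Type _ := TangentSpace 𝓘(ℝ, E) x

/-- The cotangent space `T_x^* M`. -/
abbrev Cot (x : M) : Type _ := Tan E x →L[ℝ] Bundle.Trivial M ℝ x

/-- The fibre `T_x M ⊕ T_x^* M` of the generalized tangent bundle. -/
abbrev GTan (x : M) : Type _ := Tan E x × Cot E x

/-- The neutral inner product `(X + ξ, Y + η) = ½ (ξ(Y) + η(X))` on `T_x M ⊕ T_x^* M`. -/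
def pairing (x : M) (u v : GTan E x) : ℝ := (1 / 2 : ℝ) * (u.2 v.1 + v.2 u.1)

/-- Smoothness of a section `s` of a vector bundle `V` over `M` with typical fibre `F`. -/
abbrev IsSmooth (F : Type*) [NormedAddCommGroup F] [NormedSpace ℝ F] {V : M → Type*}
    [TopologicalSpace (Bundle.TotalSpace F V)] [∀ x, TopologicalSpace (V x)]
    [FiberBundle F V] (s : ∀ x, V x) : Prop :=
  ContMDiff 𝓘(ℝ, E) (𝓘(ℝ, E).prod 𝓘(ℝ, F)) ∞
    (fun x ↦ Bundle.TotalSpace.mk' F x (s x))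

end Fibres

variable {E : Type*} [NormedAddCommGroup E] [NormedSpace ℝ E]
  {M : Type*} [TopologicalSpace M] [ChartedSpace E M]

section Calculus

/-- The differential at the point of `M` with coordinate `y ∈ E` of the parametrization of `M`
which is inverse to the preferred chart at `x₀`; it identifies `E` with a tangent space of `M`. -/
def frame (x₀ : M) (y : E) : E →L[ℝ] Tan E ((extChartAt 𝓘(ℝ, E) x₀).symm y) :=
  mfderiv 𝓘(ℝ, E) 𝓘(ℝ, E) (extChartAt 𝓘(ℝ, E) x₀).symm y

/-- The `1`-form `η` in the preferred chart at `x₀` (pullback by the parametrization). -/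
def formInChart (η : ∀ x : M, Cot E x) (x₀ : M) (y : E) : E →L[ℝ] ℝ :=
  (η ((extChartAt 𝓘(ℝ, E) x₀).symm y)).comp (frame x₀ y)

/-- The bivector field `P`, seen as a map `T^* → T`, in the preferred chart at `x₀`:
`a ↦ F⁻¹ (P (a ∘ F⁻¹))`, where `F` is the frame at the point in question. -/
def bivectorInChart (P : ∀ x : M, Cot E x →L[ℝ] Tan E x) (x₀ : M) (y : E) :
    (E →L[ℝ] ℝ) →L[ℝ] E :=
  (frame x₀ y).inverse ∘L P ((extChartAt 𝓘(ℝ, E) x₀).symm y) ∘L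
    ContinuousLinearMap.precomp ℝ (frame x₀ y).inverse

/-- The differential of a function, as a `1`-form. -/
def dFun (f : M → ℝ) (x : M) : Cot E x := mfderiv 𝓘(ℝ, E) 𝓘(ℝ, ℝ) f x

/-- The contraction `ι_X dη` of the exterior derivative of the `1`-form `η` with the vector
field `X`, that is `(ι_X dη)(w) = (D_X η)(w) - (D_w η)(X)`, computed at `x` in the preferred
chart at `x`. -/
def contractD (X : ∀ x : M, Tan E x) (η : ∀ x : M, Cot E x) (x : M) : Cot E x :=
  let φ := extChartAt 𝓘(ℝ, E) x
  let dφ : Tan E x →L[ℝ] E := mfderiv 𝓘(ℝ, E) 𝓘(ℝ, E) φ x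
  let Dη : E →L[ℝ] E →L[ℝ] ℝ := fderiv ℝ (formInChart η x) (φ x)
  (Dη (dφ (X x)) - Dη.flip (dφ (X x))).comp dφ

/-- The Lie derivative `L_X η = ι_X dη + d(η(X))` of a `1`-form. -/
def lieForm (X : ∀ x : M, Tan E x) (η : ∀ x : M, Cot E x) (x : M) : Cot E x :=
  contractD X η x + dFun (fun z ↦ η z (X z)) x

/-- The Courant bracket of sections of `TM ⊕ T^*M`:
`[X + ξ, Y + η] = [X, Y] + L_X η - L_Y ξ - ½ d(ι_X η - ι_Y ξ)`. -/
def courant (u v : ∀ x : M, GTan E x) (x : M) : GTan E x :=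
  (VectorField.mlieBracket 𝓘(ℝ, E) (fun z ↦ (u z).1) (fun z ↦ (v z).1) x,
    lieForm (fun z ↦ (u z).1) (fun z ↦ (v z).2) x
      - lieForm (fun z ↦ (v z).1) (fun z ↦ (u z).2) x
      - (1 / 2 : ℝ) • dFun (fun z ↦ (v z).2 (u z).1 - (u z).2 (v z).1) x)

/-- The Schouten bracket `[P, Q]` of two bivector fields, as a function on triples of covectors
at `x`.  With `P(α, β) = β(P α)`, in coordinates
`[P, Q](α, β, γ) = ∑ ((D_{Pα} Q)(β, γ) + (D_{Qα} P)(β, γ))`, summed over the cyclic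
permutations of `(α, β, γ)`. -/
def schouten (P Q : ∀ x : M, Cot E x →L[ℝ] Tan E x) (x : M) (α β γ : Cot E x) : ℝ :=
  let φ := extChartAt 𝓘(ℝ, E) x
  let p := bivectorInChart P x
  let q := bivectorInChart Q x
  let toE : Cot E x → (E →L[ℝ] ℝ) := fun a ↦ a.comp (mfderiv 𝓘(ℝ, E) 𝓘(ℝ, E) φ x).inverse
  let S : (E →L[ℝ] ℝ) → (E →L[ℝ] ℝ) → (E →L[ℝ] ℝ) → ℝ := fun a b c ↦
    c (fderiv ℝ q (φ x) (p (φ x) a) b) + c (fderiv ℝ p (φ x) (q (φ x) a) b)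
  S (toE α) (toE β) (toE γ) + S (toE β) (toE γ) (toE α) + S (toE γ) (toE α) (toE β)

end Calculus

section Structures

variable (E M) [IsManifold 𝓘(ℝ, E) ∞ M]

/-- A smooth bivector field on `M`, seen as a field of skew maps `T^* → T`: the bilinear form is
`P(α, β) = β(P α)`, and `P α` is the contraction of `P` with `α`. -/
structure Bivector where
  toMap : ∀ x : M, Cot E x →L[ℝ] Tan E x
  skew : ∀ (x : M) (α β : Cot E x), β (toMap x α) = -α (toMap x β)
  smooth : IsSmooth E ((E →L[ℝ] ℝ) →L[ℝ] E) toMap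

/-- A Hitchin pair of bivectors: a pair `(π, Π)` with `Π` nondegenerate, `[Π, Π] = [π, π]` and
`[Π, π] = 0`. -/
structure HitchinPair where
  (pi Pi : Bivector E M)
  nondegenerate : ∀ x, Function.Bijective (Pi.toMap x)
  schouten_eq : ∀ x, schouten Pi.toMap Pi.toMap x = schouten pi.toMap pi.toMap x
  schouten_zero : ∀ x, schouten Pi.toMap pi.toMap x = 0

variable {E M}

/-- The block `T → T` of an endomorphism of `T ⊕ T^*`. -/
def blockTT (J : ∀ x : M, GTan E x →L[ℝ] GTan E x) (x : M) : Tan E x →L[ℝ] Tan E x :=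
  ContinuousLinearMap.fst ℝ _ _ ∘L J x ∘L ContinuousLinearMap.inl ℝ _ _

/-- The block `T^* → T` of an endomorphism of `T ⊕ T^*`. -/
def blockCT (J : ∀ x : M, GTan E x →L[ℝ] GTan E x) (x : M) : Cot E x →L[ℝ] Tan E x :=
  ContinuousLinearMap.fst ℝ _ _ ∘L J x ∘L ContinuousLinearMap.inr ℝ _ _

/-- The block `T → T^*` of an endomorphism of `T ⊕ T^*`. -/
def blockTC (J : ∀ x : M, GTan E x →L[ℝ] GTan E x) (x : M) : Tan E x →L[ℝ] Cot E x :=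
  ContinuousLinearMap.snd ℝ _ _ ∘L J x ∘L ContinuousLinearMap.inl ℝ _ _

/-- The block `T^* → T^*` of an endomorphism of `T ⊕ T^*`. -/
def blockCC (J : ∀ x : M, GTan E x →L[ℝ] GTan E x) (x : M) : Cot E x →L[ℝ] Cot E x :=
  ContinuousLinearMap.snd ℝ _ _ ∘L J x ∘L ContinuousLinearMap.inr ℝ _ _

variable (E M) in
/-- A smooth section `re + i im` of the complexification `(TM ⊕ T^*M) ⊗ ℂ`, given by its real
and imaginary parts, which are smooth sections of `TM ⊕ T^*M`. -/
structure CSection where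
  (re im : ∀ x : M, GTan E x)
  smooth_re_fst : IsSmooth E E (fun x ↦ (re x).1)
  smooth_re_snd : IsSmooth E (E →L[ℝ] ℝ) (fun x ↦ (re x).2)
  smooth_im_fst : IsSmooth E E (fun x ↦ (im x).1)
  smooth_im_snd : IsSmooth E (E →L[ℝ] ℝ) (fun x ↦ (im x).2)

/-- The vector `a + i b` of `(T_x M ⊕ T_x^* M) ⊗ ℂ` lies in the eigenspace `Ker (J - l)` of the
complex linear extension of `J`: the real and imaginary parts of `J (a + i b) = l (a + i b)`. -/
def IsEigen (J : ∀ x : M, GTan E x →L[ℝ] GTan E x) (l : ℂ) (x : M) (a b : GTan E x) : Prop :=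
  J x a = l.re • a - l.im • b ∧ J x b = l.im • a + l.re • b

/-- The space of sections of the eigenspace `Ker (J - l)` is closed under the complex bilinear
extension of the Courant bracket. -/
def ClosedUnderCourant (J : ∀ x : M, GTan E x →L[ℝ] GTan E x) (l : ℂ) : Prop :=
  ∀ u v : CSection E M, (∀ x, IsEigen J l x (u.re x) (u.im x)) →
    (∀ x, IsEigen J l x (v.re x) (v.im x)) → ∀ x, IsEigen J l x
      (courant u.re v.re x - courant u.im v.im x) (courant u.re v.im x + courant u.im v.re x)

variable (E M) in
/-- A generalized complex structure on `M`: a smooth bundle endomorphism `J` of `TM ⊕ T^*M` with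
`J² = -1`, skew for the neutral inner product, whose two eigenspaces have their spaces of
sections closed under the Courant bracket. -/
structure GCStructure where
  toMap : ∀ x : M, GTan E x →L[ℝ] GTan E x
  smoothTT : IsSmooth E (E →L[ℝ] E) (blockTT toMap)
  smoothCT : IsSmooth E ((E →L[ℝ] ℝ) →L[ℝ] E) (blockCT toMap)
  smoothTC : IsSmooth E (E →L[ℝ] E →L[ℝ] ℝ) (blockTC toMap)
  smoothCC : IsSmooth E ((E →L[ℝ] ℝ) →L[ℝ] E →L[ℝ] ℝ) (blockCC toMap)
  sq_eq : ∀ (x : M) (u : GTan E x), toMap x (toMap x u) = -u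
  skew : ∀ (x : M) (u v : GTan E x), pairing E x (toMap x u) v = -pairing E x u (toMap x v)
  integrable : ClosedUnderCourant toMap Complex.I ∧ ClosedUnderCourant toMap (-Complex.I)

end Structures

end GenComplex

end

/-! Suppose σ is invertible and put Π = σ⁻¹, π = A σ⁻¹. For l = ±i the T^*-component of J(X + ξ) =
l(X + ξ) solves to X = (π + lΠ)ξ, and the T-component is then automatic. So the two eigenbundles are
the graphs of the complex bivectors π ± iΠ. Conversely, the blocks of J are recovered from π and Π:
J² = -1 expresses the blocks on T^* through A and σ, and skewness of J corresponds to skewness of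
both bivectors.

For two sections of the graph of β = π + iεΠ over forms ξ and η, the deviation of their Courant
bracket from the graph, paired with γ, is ½[β, β](ξ, η, γ): by skewness of β all derivatives of ξ
and η cancel. Closure is therefore equivalent to [β, β] = 0. Its real part is [π, π] = [Π, Π] and
its imaginary part is [Π, π] = 0; the other eigenvalue gives the conjugate equation.

The pointwise identity is `graph_re` and `graph_im`, carried to the manifold by `courant_graph`.
`HasHitchinBlocks.isEigen_iff` identifies eigenspaces with graphs.
`HasHitchinBlocks.closedUnderCourant` and `HasHitchinBlocks.schouten_eq` are the two directions of
the integrability criterion; the latter needs a smooth section through every covector, supplied by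
`exists_isSmooth_apply_eq`. -/

noncomputable section

namespace GenComplex

/-! ### The graph identity for 1-jets at a point of a vector space -/

section Algebra

variable {E : Type*} [NormedAddCommGroup E] [NormedSpace ℝ E]

/-- The value at `w` of the covector part of the Courant bracket of two sections which have, in a
chart, the values `(X, ξ)`, `(Y, η)` and the derivatives `(DX, Dξ)`, `(DY, Dη)`. -/
def courantForm (X : E) (DX : E →L[ℝ] E) (ξ : E →L[ℝ] ℝ) (Dξ : E →L[ℝ] E →L[ℝ] ℝ)
    (Y : E) (DY : E →L[ℝ] E) (η : E →L[ℝ] ℝ) (Dη : E →L[ℝ] E →L[ℝ] ℝ) (w : E) : ℝ :=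
  Dη X w - Dη w X - (Dξ Y w - Dξ w Y) +
    (1 / 2 : ℝ) * (Dη w X + η (DX w) - (Dξ w Y + ξ (DY w)))

/-- The term `c ((D_{p a} q) b) + c ((D_{q a} p) b)` of the Schouten bracket of two bivectors with
values `p`, `q` and derivatives `Dp`, `Dq`. -/
def schoutenTerm (p q : (E →L[ℝ] ℝ) →L[ℝ] E) (Dp Dq : E →L[ℝ] (E →L[ℝ] ℝ) →L[ℝ] E)
    (a b c : E →L[ℝ] ℝ) : ℝ :=
  c (Dq (p a) b) + c (Dp (q a) b)

/-- The Schouten bracket, at `(a, b, c)`, of two bivectors with values `p`, `q` and derivatives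
`Dp`, `Dq`. -/
def schoutenSum (p q : (E →L[ℝ] ℝ) →L[ℝ] E) (Dp Dq : E →L[ℝ] (E →L[ℝ] ℝ) →L[ℝ] E)
    (a b c : E →L[ℝ] ℝ) : ℝ :=
  schoutenTerm p q Dp Dq a b c + schoutenTerm p q Dp Dq b c a + schoutenTerm p q Dp Dq c a b

variable {p q : (E →L[ℝ] ℝ) →L[ℝ] E} {Dp Dq : E →L[ℝ] (E →L[ℝ] ℝ) →L[ℝ] E}

/-- The real part of the tensoriality of the Courant bracket on the graph of the complex bivector
`p + iq`: its deviation from the graph is the Schouten bracket. -/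
theorem graph_re (hp : ∀ a b : E →L[ℝ] ℝ, b (p a) = -a (p b))
    (hq : ∀ a b : E →L[ℝ] ℝ, b (q a) = -a (q b))
    (hDp : ∀ w, ∀ a b : E →L[ℝ] ℝ, b (Dp w a) = -a (Dp w b))
    (hDq : ∀ w, ∀ a b : E →L[ℝ] ℝ, b (Dq w a) = -a (Dq w b))
    (ξ ξ' η η' c : E →L[ℝ] ℝ) (Dξ Dξ' Dη Dη' : E →L[ℝ] E →L[ℝ] ℝ)
    (X X' Y Y' : E) (DX DX' DY DY' : E →L[ℝ] E)
    (hX : X = p ξ - q ξ') (hX' : X' = p ξ' + q ξ)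
    (hY : Y = p η - q η') (hY' : Y' = p η' + q η)
    (hDX : ∀ w, DX w = Dp w ξ + p (Dξ w) - (Dq w ξ' + q (Dξ' w)))
    (hDX' : ∀ w, DX' w = Dp w ξ' + p (Dξ' w) + (Dq w ξ + q (Dξ w)))
    (hDY : ∀ w, DY w = Dp w η + p (Dη w) - (Dq w η' + q (Dη' w)))
    (hDY' : ∀ w, DY' w = Dp w η' + p (Dη' w) + (Dq w η + q (Dη w))) :
    c ((DY X - DX Y) - (DY' X' - DX' Y'))
      + (courantForm X DX ξ Dξ Y DY η Dη (p c) - courantForm X' DX' ξ' Dξ' Y' DY' η' Dη' (p c))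
      - (courantForm X DX ξ Dξ Y' DY' η' Dη' (q c) + courantForm X' DX' ξ' Dξ' Y DY η Dη (q c)) =
    (1 / 2 : ℝ) * (schoutenSum p p Dp Dp ξ η c - schoutenSum q q Dq Dq ξ η c)
     - (1 / 2 : ℝ) * (schoutenSum p p Dp Dp ξ' η' c - schoutenSum q q Dq Dq ξ' η' c)
     - schoutenSum q p Dq Dp ξ η' c - schoutenSum q p Dq Dp ξ' η c := by
  -- Skewness moves p and q off the derivatives of the forms, so that these terms cancel against
  -- those of the covector part of the bracket. The remaining identities bring each pairing through
  -- Dp or Dq into one fixed order, which leaves a polynomial identity.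
  have e1 : ∀ (T : E →L[ℝ] E →L[ℝ] ℝ) w a, a (p (T w)) = -(T w) (p a) := fun T w a ↦ hp _ _
  have e2 : ∀ (T : E →L[ℝ] E →L[ℝ] ℝ) w a, a (q (T w)) = -(T w) (q a) := fun T w a ↦ hq _ _
  have f1 : ∀ w, η (Dp w ξ) = -ξ (Dp w η) := fun w ↦ hDp _ _ _
  have f2 : ∀ w, η' (Dp w ξ) = -ξ (Dp w η') := fun w ↦ hDp _ _ _
  have f3 : ∀ w, η (Dp w ξ') = -ξ' (Dp w η) := fun w ↦ hDp _ _ _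
  have f4 : ∀ w, η' (Dp w ξ') = -ξ' (Dp w η') := fun w ↦ hDp _ _ _
  have f5 : ∀ w, c (Dp w ξ) = -ξ (Dp w c) := fun w ↦ hDp _ _ _
  have f6 : ∀ w, c (Dp w ξ') = -ξ' (Dp w c) := fun w ↦ hDp _ _ _
  have f7 : ∀ w, c (Dp w η) = -η (Dp w c) := fun w ↦ hDp _ _ _
  have f8 : ∀ w, c (Dp w η') = -η' (Dp w c) := fun w ↦ hDp _ _ _
  have g1 : ∀ w, η (Dq w ξ) = -ξ (Dq w η) := fun w ↦ hDq _ _ _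
  have g2 : ∀ w, η' (Dq w ξ) = -ξ (Dq w η') := fun w ↦ hDq _ _ _
  have g3 : ∀ w, η (Dq w ξ') = -ξ' (Dq w η) := fun w ↦ hDq _ _ _
  have g4 : ∀ w, η' (Dq w ξ') = -ξ' (Dq w η') := fun w ↦ hDq _ _ _
  have g5 : ∀ w, c (Dq w ξ) = -ξ (Dq w c) := fun w ↦ hDq _ _ _
  have g6 : ∀ w, c (Dq w ξ') = -ξ' (Dq w c) := fun w ↦ hDq _ _ _
  have g7 : ∀ w, c (Dq w η) = -η (Dq w c) := fun w ↦ hDq _ _ _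
  have g8 : ∀ w, c (Dq w η') = -η' (Dq w c) := fun w ↦ hDq _ _ _
  simp only [schoutenSum, schoutenTerm, courantForm, hDX, hDX', hDY, hDY', hX, hX', hY, hY',
    map_add, map_sub, add_apply, sub_apply, e1, e2,
    f1, f2, f3, f4, f5, f6, f7, f8, g1, g2, g3, g4, g5, g6, g7, g8]
  ring

/-- The imaginary part of the tensoriality of the Courant bracket on the graph of `p + iq`. -/
theorem graph_im (hp : ∀ a b : E →L[ℝ] ℝ, b (p a) = -a (p b))
    (hq : ∀ a b : E →L[ℝ] ℝ, b (q a) = -a (q b))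
    (hDp : ∀ w, ∀ a b : E →L[ℝ] ℝ, b (Dp w a) = -a (Dp w b))
    (hDq : ∀ w, ∀ a b : E →L[ℝ] ℝ, b (Dq w a) = -a (Dq w b))
    (ξ ξ' η η' c : E →L[ℝ] ℝ) (Dξ Dξ' Dη Dη' : E →L[ℝ] E →L[ℝ] ℝ)
    (X X' Y Y' : E) (DX DX' DY DY' : E →L[ℝ] E)
    (hX : X = p ξ - q ξ') (hX' : X' = p ξ' + q ξ)
    (hY : Y = p η - q η') (hY' : Y' = p η' + q η)
    (hDX : ∀ w, DX w = Dp w ξ + p (Dξ w) - (Dq w ξ' + q (Dξ' w)))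
    (hDX' : ∀ w, DX' w = Dp w ξ' + p (Dξ' w) + (Dq w ξ + q (Dξ w)))
    (hDY : ∀ w, DY w = Dp w η + p (Dη w) - (Dq w η' + q (Dη' w)))
    (hDY' : ∀ w, DY' w = Dp w η' + p (Dη' w) + (Dq w η + q (Dη w))) :
    c ((DY' X - DX Y') + (DY X' - DX' Y))
      + (courantForm X DX ξ Dξ Y' DY' η' Dη' (p c) + courantForm X' DX' ξ' Dξ' Y DY η Dη (p c))
      + (courantForm X DX ξ Dξ Y DY η Dη (q c) - courantForm X' DX' ξ' Dξ' Y' DY' η' Dη' (q c)) =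
    (1 / 2 : ℝ) * (schoutenSum p p Dp Dp ξ η' c - schoutenSum q q Dq Dq ξ η' c)
     + (1 / 2 : ℝ) * (schoutenSum p p Dp Dp ξ' η c - schoutenSum q q Dq Dq ξ' η c)
     + schoutenSum q p Dq Dp ξ η c - schoutenSum q p Dq Dp ξ' η' c := by
  have e1 : ∀ (T : E →L[ℝ] E →L[ℝ] ℝ) w a, a (p (T w)) = -(T w) (p a) := fun T w a ↦ hp _ _
  have e2 : ∀ (T : E →L[ℝ] E →L[ℝ] ℝ) w a, a (q (T w)) = -(T w) (q a) := fun T w a ↦ hq _ _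
  have f1 : ∀ w, η (Dp w ξ) = -ξ (Dp w η) := fun w ↦ hDp _ _ _
  have f2 : ∀ w, η' (Dp w ξ) = -ξ (Dp w η') := fun w ↦ hDp _ _ _
  have f3 : ∀ w, η (Dp w ξ') = -ξ' (Dp w η) := fun w ↦ hDp _ _ _
  have f4 : ∀ w, η' (Dp w ξ') = -ξ' (Dp w η') := fun w ↦ hDp _ _ _
  have f5 : ∀ w, c (Dp w ξ) = -ξ (Dp w c) := fun w ↦ hDp _ _ _
  have f6 : ∀ w, c (Dp w ξ') = -ξ' (Dp w c) := fun w ↦ hDp _ _ _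
  have f7 : ∀ w, c (Dp w η) = -η (Dp w c) := fun w ↦ hDp _ _ _
  have f8 : ∀ w, c (Dp w η') = -η' (Dp w c) := fun w ↦ hDp _ _ _
  have g1 : ∀ w, η (Dq w ξ) = -ξ (Dq w η) := fun w ↦ hDq _ _ _
  have g2 : ∀ w, η' (Dq w ξ) = -ξ (Dq w η') := fun w ↦ hDq _ _ _
  have g3 : ∀ w, η (Dq w ξ') = -ξ' (Dq w η) := fun w ↦ hDq _ _ _
  have g4 : ∀ w, η' (Dq w ξ') = -ξ' (Dq w η') := fun w ↦ hDq _ _ _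
  have g5 : ∀ w, c (Dq w ξ) = -ξ (Dq w c) := fun w ↦ hDq _ _ _
  have g6 : ∀ w, c (Dq w ξ') = -ξ' (Dq w c) := fun w ↦ hDq _ _ _
  have g7 : ∀ w, c (Dq w η) = -η (Dq w c) := fun w ↦ hDq _ _ _
  have g8 : ∀ w, c (Dq w η') = -η' (Dq w c) := fun w ↦ hDq _ _ _
  simp only [schoutenSum, schoutenTerm, courantForm, hDX, hDX', hDY, hDY', hX, hX', hY, hY',
    map_add, map_sub, add_apply, sub_apply, e1, e2,
    f1, f2, f3, f4, f5, f6, f7, f8, g1, g2, g3, g4, g5, g6, g7, g8]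
  ring

end Algebra

/-! ### Tensor fields in the preferred chart -/

section Chart

open Bundle Filter Topology

variable {E : Type*} [NormedAddCommGroup E] [NormedSpace ℝ E]
  {M : Type*} [TopologicalSpace M] [ChartedSpace E M]

/-- The vector field `X` in the preferred chart at `x₀`. -/
def vectorInChart (X : ∀ x : M, Tan E x) (x₀ : M) (y : E) : E :=
  (frame x₀ y).inverse (X ((extChartAt 𝓘(ℝ, E) x₀).symm y))

theorem bivectorInChart_skew {P : ∀ x : M, Cot E x →L[ℝ] Tan E x}
    (hP : ∀ (x : M) (α β : Cot E x), β (P x α) = -α (P x β)) (x₀ : M) (y : E)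
    (a b : E →L[ℝ] ℝ) : b (bivectorInChart P x₀ y a) = -a (bivectorInChart P x₀ y b) :=
  hP _ (a.comp (frame x₀ y).inverse) (b.comp (frame x₀ y).inverse)

theorem frame_eq_mfderivWithin (x₀ : M) (y : E) :
    frame x₀ y = mfderivWithin 𝓘(ℝ, E) 𝓘(ℝ, E) (extChartAt 𝓘(ℝ, E) x₀).symm
      (Set.range 𝓘(ℝ, E)) y := by
  rw [modelWithCornersSelf_coe, Set.range_id, mfderivWithin_univ]
  rfl

theorem eventually_mem_target (x : M) :
    ∀ᶠ y in 𝓝 (extChartAt 𝓘(ℝ, E) x x), y ∈ (extChartAt 𝓘(ℝ, E) x).target :=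
  extChartAt_target_mem_nhds x

theorem dFun_eq {f : M → ℝ} {x : M} (hf : MDifferentiableAt 𝓘(ℝ, E) 𝓘(ℝ, ℝ) f x) :
    (dFun f x : E →L[ℝ] ℝ) =
      fderiv ℝ (fun y ↦ f ((extChartAt 𝓘(ℝ, E) x).symm y)) (extChartAt 𝓘(ℝ, E) x x) := by
  unfold dFun
  rw [hf.mfderiv]
  simp [writtenInExtChartAt]
  rfl

variable [IsManifold 𝓘(ℝ, E) ∞ M]

/-- The chart frame is the inverse of the tangent bundle trivialization, so chart expressions of
tensor fields are their coordinates in the bundle trivializations and inherit their smoothness. -/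
theorem frame_eq_symmL {x₀ : M} {y : E} (hy : y ∈ (extChartAt 𝓘(ℝ, E) x₀).target) :
    frame x₀ y = (trivializationAt E (TangentSpace 𝓘(ℝ, E)) x₀).symmL ℝ
      ((extChartAt 𝓘(ℝ, E) x₀).symm y) := by
  have h := (extChartAt 𝓘(ℝ, E) x₀).map_target hy
  rw [extChartAt_source] at h
  rw [TangentBundle.symmL_trivializationAt h]
  rw [(extChartAt 𝓘(ℝ, E) x₀).right_inv hy]
  exact frame_eq_mfderivWithin x₀ y

theorem frame_inverse_eq {x₀ : M} {y : E} (hy : y ∈ (extChartAt 𝓘(ℝ, E) x₀).target) :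
    (frame x₀ y).inverse =
      (trivializationAt E (TangentSpace 𝓘(ℝ, E)) x₀).continuousLinearMapAt ℝ
        ((extChartAt 𝓘(ℝ, E) x₀).symm y) := by
  have h := (extChartAt 𝓘(ℝ, E) x₀).map_target hy
  rw [extChartAt_source] at h
  rw [TangentBundle.continuousLinearMapAt_trivializationAt h, frame_eq_mfderivWithin]
  exact ContinuousLinearMap.inverse_eq
    (mfderivWithin_extChartAt_symm_comp_mfderiv_extChartAt hy)
    (mfderiv_extChartAt_comp_mfderivWithin_extChartAt_symm hy)

theorem frame_isInvertible {x₀ : M} {y : E} (hy : y ∈ (extChartAt 𝓘(ℝ, E) x₀).target) :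
    (frame x₀ y).IsInvertible := by
  rw [frame_eq_mfderivWithin]
  exact isInvertible_mfderivWithin_extChartAt_symm hy

/-- The tangent space at x is the model space E read in the preferred chart at x, so at the centre
of that chart no change of frame is needed. -/
theorem frame_self (x : M) :
    frame x (extChartAt 𝓘(ℝ, E) x x) = ContinuousLinearMap.id ℝ E := by
  have := mfderivWithin_range_extChartAt_symm (I := 𝓘(ℝ, E)) (x := x)
  simpa [frame] using! this

theorem vectorInChart_self (X : ∀ x : M, Tan E x) (x : M) :
    vectorInChart X x (extChartAt 𝓘(ℝ, E) x x) = X x := by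
  have h : (frame x (extChartAt 𝓘(ℝ, E) x x)).inverse = ContinuousLinearMap.id ℝ E := by
    rw [frame_self]
    exact ContinuousLinearMap.inverse_id
  -- The points φ⁻¹(φ x) and x are only propositionally equal, so the two fibres are compared as
  -- copies of E.
  have hX : ∀ z, z = x → (X z : E) = X x := by
    rintro _ rfl
    rfl
  unfold vectorInChart
  rw [h]
  exact hX _ (extChartAt_to_inv x)

theorem formInChart_self (η : ∀ x : M, Cot E x) (x : M) :
    formInChart η x (extChartAt 𝓘(ℝ, E) x x) = η x := by
  have hη : ∀ z, z = x → (η z : E →L[ℝ] ℝ) = η x := by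
    rintro _ rfl
    rfl
  unfold formInChart
  rw [frame_self]
  exact hη _ (extChartAt_to_inv x)

theorem bivectorInChart_self (P : ∀ x : M, Cot E x →L[ℝ] Tan E x) (x : M) :
    bivectorInChart P x (extChartAt 𝓘(ℝ, E) x x) = P x := by
  have h : (frame x (extChartAt 𝓘(ℝ, E) x x)).inverse = ContinuousLinearMap.id ℝ E := by
    rw [frame_self]
    exact ContinuousLinearMap.inverse_id
  have hP : ∀ z, z = x → (P z : (E →L[ℝ] ℝ) →L[ℝ] E) = P x := by
    rintro _ rfl
    rfl
  unfold bivectorInChart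
  rw [h]
  exact hP _ (extChartAt_to_inv x)

theorem formInChart_apply_vectorInChart (η : ∀ x : M, Cot E x) (X : ∀ x : M, Tan E x) {x₀ : M}
    {y : E} (hy : y ∈ (extChartAt 𝓘(ℝ, E) x₀).target) :
    formInChart η x₀ y (vectorInChart X x₀ y) =
      η ((extChartAt 𝓘(ℝ, E) x₀).symm y) (X ((extChartAt 𝓘(ℝ, E) x₀).symm y)) := by
  change η _ (frame x₀ y ((frame x₀ y).inverse _)) = _
  rw [(frame_isInvertible hy).self_apply_inverse]

theorem bivectorInChart_apply_formInChart (P : ∀ x : M, Cot E x →L[ℝ] Tan E x)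
    (η : ∀ x : M, Cot E x) {x₀ : M}
    {y : E} (hy : y ∈ (extChartAt 𝓘(ℝ, E) x₀).target) :
    bivectorInChart P x₀ y (formInChart η x₀ y) = vectorInChart (fun z ↦ P z (η z)) x₀ y := by
  have h : ((η ((extChartAt 𝓘(ℝ, E) x₀).symm y)).comp (frame x₀ y)).comp (frame x₀ y).inverse
      = η ((extChartAt 𝓘(ℝ, E) x₀).symm y) := by
    ext v
    change η _ (frame x₀ y ((frame x₀ y).inverse v)) = _
    rw [(frame_isInvertible hy).self_apply_inverse]
  change (frame x₀ y).inverse (P _ (((η _).comp (frame x₀ y)).comp (frame x₀ y).inverse)) = _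
  rw [h]
  rfl

theorem mlieBracket_eq (X Y : ∀ x : M, Tan E x) (x : M) :
    (VectorField.mlieBracket 𝓘(ℝ, E) X Y x : E) =
      fderiv ℝ (vectorInChart Y x) (extChartAt 𝓘(ℝ, E) x x) (X x) -
      fderiv ℝ (vectorInChart X x) (extChartAt 𝓘(ℝ, E) x x) (Y x) := by
  -- Pulling back along the inverse chart is passing to chart coordinates, which turns the manifold
  -- bracket into the bracket on E.
  have hm : ∀ Z : ∀ x : M, Tan E x,
      (VectorField.mpullbackWithin 𝓘(ℝ, E) 𝓘(ℝ, E) (extChartAt 𝓘(ℝ, E) x).symm Z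
        (Set.range 𝓘(ℝ, E)) : E → E) = vectorInChart Z x := by
    intro Z
    ext y
    rw [VectorField.mpullbackWithin_apply, ← frame_eq_mfderivWithin]
    rfl
  rw [← VectorField.mlieBracketWithin_univ, VectorField.mlieBracketWithin_apply,
    mfderiv_extChartAt_self]
  change ContinuousLinearMap.inverse (ContinuousLinearMap.id ℝ E) _ = _
  rw [ContinuousLinearMap.inverse_id]
  erw [hm X, hm Y]
  rw [Set.preimage_univ, Set.univ_inter, modelWithCornersSelf_coe, Set.range_id,
    VectorField.lieBracketWithin_univ, VectorField.lieBracket, vectorInChart_self,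
    vectorInChart_self]
  rfl

theorem contractD_apply (X : ∀ x : M, Tan E x) (η : ∀ x : M, Cot E x) (x : M) (w : E) :
    contractD X η x w = fderiv ℝ (formInChart η x) (extChartAt 𝓘(ℝ, E) x x) (X x) w -
      fderiv ℝ (formInChart η x) (extChartAt 𝓘(ℝ, E) x x) w (X x) := by
  have h : (mfderiv 𝓘(ℝ, E) 𝓘(ℝ, E) (extChartAt 𝓘(ℝ, E) x) x : E →L[ℝ] E) =
      ContinuousLinearMap.id ℝ E := mfderiv_extChartAt_self
  change (fun T : E →L[ℝ] E ↦ (fderiv ℝ (formInChart η x) (extChartAt 𝓘(ℝ, E) x x) (T (X x))) (T w)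
    - fderiv ℝ (formInChart η x) (extChartAt 𝓘(ℝ, E) x x) (T w) (T (X x)))
    (mfderiv 𝓘(ℝ, E) 𝓘(ℝ, E) (extChartAt 𝓘(ℝ, E) x) x : E →L[ℝ] E) = _
  rw [h]
  rfl

theorem differentiableAt_trivialization {F : Type*} [NormedAddCommGroup F] [NormedSpace ℝ F]
    {V : M → Type*} [∀ x, AddCommGroup (V x)] [∀ x, Module ℝ (V x)]
    [TopologicalSpace (TotalSpace F V)] [∀ x, TopologicalSpace (V x)]
    [FiberBundle F V] {s : ∀ x, V x} (hs : IsSmooth E F s) (x : M) :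
    DifferentiableAt ℝ (fun y ↦ (trivializationAt F V x
      ⟨(extChartAt 𝓘(ℝ, E) x).symm y, s ((extChartAt 𝓘(ℝ, E) x).symm y)⟩).2)
      (extChartAt 𝓘(ℝ, E) x x) := by
  have h1 := (contMDiffAt_section x).1 (hs x)
  have h2 : ContMDiffAt 𝓘(ℝ, E) 𝓘(ℝ, E) ∞ (extChartAt 𝓘(ℝ, E) x).symm
      (extChartAt 𝓘(ℝ, E) x x) :=
    (contMDiffOn_extChartAt_symm x).contMDiffAt (extChartAt_target_mem_nhds x)
  have h3 := ContMDiffAt.comp_of_eq h1 h2 (extChartAt_to_inv x)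
  exact (contMDiffAt_iff_contDiffAt.1 h3).differentiableAt (by simp)

theorem differentiableAt_vectorInChart {X : ∀ x : M, Tan E x} (hX : IsSmooth E E X) (x : M) :
    DifferentiableAt ℝ (vectorInChart X x) (extChartAt 𝓘(ℝ, E) x x) := by
  refine (differentiableAt_trivialization hX x).congr_of_eventuallyEq ?_
  filter_upwards [eventually_mem_target x] with y hy
  rw [vectorInChart, frame_inverse_eq hy, Trivialization.continuousLinearMapAt_apply,
    Trivialization.linearMapAt_apply, if_pos]
  simpa using (extChartAt 𝓘(ℝ, E) x).map_target hy

theorem differentiableAt_formInChart {η : ∀ x : M, Cot E x} (hη : IsSmooth E (E →L[ℝ] ℝ) η)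
    (x : M) : DifferentiableAt ℝ (formInChart η x) (extChartAt 𝓘(ℝ, E) x x) := by
  refine (differentiableAt_trivialization hη x).congr_of_eventuallyEq ?_
  filter_upwards [eventually_mem_target x] with y hy
  rw [hom_trivializationAt_apply, formInChart, frame_eq_symmL hy]
  ext v
  simp [ContinuousLinearMap.inCoordinates]
  rfl

/-- The cotangent trivialization is the transpose of the inverse tangent one. It is applied to the
candidate covector, and its injectivity on the fibre gives the claim. -/
theorem cotangent_symmL (x₀ : M) {z : M} (hz : z ∈ (chartAt E x₀).source) (a : E →L[ℝ] ℝ) :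
    (trivializationAt (E →L[ℝ] ℝ) (fun x : M ↦ Cot E x) x₀).symmL ℝ z a =
      a.comp ((trivializationAt E (TangentSpace 𝓘(ℝ, E)) x₀).continuousLinearMapAt ℝ z) := by
  have hz' : z ∈ (trivializationAt E (TangentSpace 𝓘(ℝ, E)) x₀).baseSet := hz
  have hz'' : z ∈ (trivializationAt (E →L[ℝ] ℝ) (fun x : M ↦ Cot E x) x₀).baseSet :=
    ⟨hz, Set.mem_univ _⟩
  set b : Cot E z :=
    a.comp ((trivializationAt E (TangentSpace 𝓘(ℝ, E)) x₀).continuousLinearMapAt ℝ z) with hb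
  have h : (trivializationAt (E →L[ℝ] ℝ) (fun x : M ↦ Cot E x) x₀).continuousLinearMapAt ℝ z b =
      a := by
    rw [Trivialization.continuousLinearMapAt_apply, Trivialization.linearMapAt_apply,
      if_pos hz'', hom_trivializationAt_apply]
    ext v
    change (trivializationAt ℝ (Bundle.Trivial M ℝ) x₀).continuousLinearMapAt ℝ z
      (a ((trivializationAt E (TangentSpace 𝓘(ℝ, E)) x₀).continuousLinearMapAt ℝ z
      ((trivializationAt E (TangentSpace 𝓘(ℝ, E)) x₀).symmL ℝ z v))) = a v
    rw [Trivialization.continuousLinearMapAt_symmL _ hz']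
    simp
  rw [← h, Trivialization.symmL_continuousLinearMapAt _ hz'']

theorem differentiableAt_bivectorInChart {P : ∀ x : M, Cot E x →L[ℝ] Tan E x}
    (hP : IsSmooth E ((E →L[ℝ] ℝ) →L[ℝ] E) P)
    (x : M) : DifferentiableAt ℝ (bivectorInChart P x) (extChartAt 𝓘(ℝ, E) x x) := by
  refine (differentiableAt_trivialization hP x).congr_of_eventuallyEq ?_
  filter_upwards [eventually_mem_target x] with y hy
  rw [hom_trivializationAt_apply, bivectorInChart, frame_inverse_eq hy]
  ext v
  rw [ContinuousLinearMap.inCoordinates]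
  change _ = (trivializationAt E (TangentSpace 𝓘(ℝ, E)) x).continuousLinearMapAt ℝ _ (P _
    ((trivializationAt (E →L[ℝ] ℝ) (fun x : M ↦ Cot E x) x).symmL ℝ _ v))
  rw [cotangent_symmL x (by simpa using (extChartAt 𝓘(ℝ, E) x).map_target hy)]
  rfl

end Chart

/-! ### Smooth bundle maps, their inverses, and extension of vectors to sections -/

section Sections

open Bundle Filter Topology

variable {E : Type*} [NormedAddCommGroup E] [NormedSpace ℝ E]
  {M : Type*} [TopologicalSpace M] [ChartedSpace E M]
  {F₁ F₂ F₃ : Type*} [NormedAddCommGroup F₁] [NormedSpace ℝ F₁]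
  [NormedAddCommGroup F₂] [NormedSpace ℝ F₂] [NormedAddCommGroup F₃] [NormedSpace ℝ F₃]
  {V₁ V₂ V₃ : M → Type*}
  [∀ x, AddCommGroup (V₁ x)] [∀ x, Module ℝ (V₁ x)] [∀ x, TopologicalSpace (V₁ x)]
  [TopologicalSpace (TotalSpace F₁ V₁)] [FiberBundle F₁ V₁] [VectorBundle ℝ F₁ V₁]
  [∀ x, AddCommGroup (V₂ x)] [∀ x, Module ℝ (V₂ x)] [∀ x, TopologicalSpace (V₂ x)]
  [TopologicalSpace (TotalSpace F₂ V₂)] [FiberBundle F₂ V₂] [VectorBundle ℝ F₂ V₂]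
  [∀ x, AddCommGroup (V₃ x)] [∀ x, Module ℝ (V₃ x)] [∀ x, TopologicalSpace (V₃ x)]
  [TopologicalSpace (TotalSpace F₃ V₃)] [FiberBundle F₃ V₃] [VectorBundle ℝ F₃ V₃]

theorem eventually_mem_baseSet (F : Type*) [NormedAddCommGroup F]
    (V : M → Type*) [∀ x, TopologicalSpace (V x)] [TopologicalSpace (TotalSpace F V)]
    [FiberBundle F V] (x₀ : M) : ∀ᶠ x in 𝓝 x₀, x ∈ (trivializationAt F V x₀).baseSet :=
  (trivializationAt F V x₀).open_baseSet.mem_nhds (FiberBundle.mem_baseSet_trivializationAt' x₀)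

theorem inCoordinates_comp {x₀ x : M} (hx : x ∈ (trivializationAt F₂ V₂ x₀).baseSet)
    (t : V₂ x →L[ℝ] V₃ x) (s : V₁ x →L[ℝ] V₂ x) :
    ContinuousLinearMap.inCoordinates F₁ V₁ F₃ V₃ x₀ x x₀ x (t ∘L s) =
      (ContinuousLinearMap.inCoordinates F₂ V₂ F₃ V₃ x₀ x x₀ x t).comp
        (ContinuousLinearMap.inCoordinates F₁ V₁ F₂ V₂ x₀ x x₀ x s) := by
  ext v
  simp only [ContinuousLinearMap.inCoordinates, ContinuousLinearMap.comp_apply]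
  rw [Trivialization.symmL_continuousLinearMapAt _ hx]

variable [∀ x, IsTopologicalAddGroup (V₂ x)] [∀ x, ContinuousSMul ℝ (V₂ x)]

theorem isSmooth_hom_iff {s : ∀ x, V₁ x →L[ℝ] V₂ x} :
    IsSmooth E (F₁ →L[ℝ] F₂) s ↔ ∀ x₀, ContMDiffAt 𝓘(ℝ, E) 𝓘(ℝ, F₁ →L[ℝ] F₂) ∞
      (fun x ↦ ContinuousLinearMap.inCoordinates F₁ V₁ F₂ V₂ x₀ x x₀ x (s x)) x₀ := by
  refine forall_congr' fun x₀ ↦ ?_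
  rw [contMDiffAt_hom_bundle]
  exact and_iff_right contMDiffAt_id

theorem IsSmooth.comp [∀ x, IsTopologicalAddGroup (V₃ x)] [∀ x, ContinuousSMul ℝ (V₃ x)]
    {t : ∀ x, V₂ x →L[ℝ] V₃ x} {s : ∀ x, V₁ x →L[ℝ] V₂ x}
    (ht : IsSmooth E (F₂ →L[ℝ] F₃) t) (hs : IsSmooth E (F₁ →L[ℝ] F₂) s) :
    IsSmooth E (F₁ →L[ℝ] F₃) (fun x ↦ t x ∘L s x) := by
  rw [isSmooth_hom_iff] at ht hs ⊢
  intro x₀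
  refine ((ht x₀).clm_comp (hs x₀)).congr_of_eventuallyEq ?_
  filter_upwards [eventually_mem_baseSet F₂ V₂ x₀] with x hx
  exact inCoordinates_comp hx _ _

/-- In local coordinates t is the operator inverse of s, and inversion is smooth at invertible
operators between Banach spaces. -/
theorem IsSmooth.inverse [CompleteSpace F₁] [∀ x, IsTopologicalAddGroup (V₁ x)]
    [∀ x, ContinuousSMul ℝ (V₁ x)] {s : ∀ x, V₁ x →L[ℝ] V₂ x} {t : ∀ x, V₂ x →L[ℝ] V₁ x}
    (hs : IsSmooth E (F₁ →L[ℝ] F₂) s) (hst : ∀ x v, s x (t x v) = v)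
    (hts : ∀ x v, t x (s x v) = v) : IsSmooth E (F₂ →L[ℝ] F₁) t := by
  rw [isSmooth_hom_iff] at hs ⊢
  intro x₀
  have key : ∀ᶠ x in 𝓝 x₀,
      (ContinuousLinearMap.inCoordinates F₂ V₂ F₁ V₁ x₀ x x₀ x (t x)).comp
        (ContinuousLinearMap.inCoordinates F₁ V₁ F₂ V₂ x₀ x x₀ x (s x)) = .id ℝ F₁ ∧
      (ContinuousLinearMap.inCoordinates F₁ V₁ F₂ V₂ x₀ x x₀ x (s x)).comp
        (ContinuousLinearMap.inCoordinates F₂ V₂ F₁ V₁ x₀ x x₀ x (t x)) = .id ℝ F₂ := by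
    filter_upwards [eventually_mem_baseSet F₁ V₁ x₀, eventually_mem_baseSet F₂ V₂ x₀] with x h1 h2
    have e1 : t x ∘L s x = .id ℝ _ := by ext v; exact hts x v
    have e2 : s x ∘L t x = .id ℝ _ := by ext v; exact hst x v
    rw [← inCoordinates_comp h2, ← inCoordinates_comp h1, e1, e2]
    constructor
    · ext v
      simp only [ContinuousLinearMap.inCoordinates, ContinuousLinearMap.comp_apply,
        ContinuousLinearMap.id_apply]
      rw [Trivialization.continuousLinearMapAt_symmL _ h1]
    · ext v
      simp only [ContinuousLinearMap.inCoordinates, ContinuousLinearMap.comp_apply,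
        ContinuousLinearMap.id_apply]
      rw [Trivialization.continuousLinearMapAt_symmL _ h2]
  have hinv : (ContinuousLinearMap.inCoordinates F₁ V₁ F₂ V₂ x₀ x₀ x₀ x₀ (s x₀)).IsInvertible :=
    .of_inverse key.self_of_nhds.2 key.self_of_nhds.1
  refine ((hinv.contDiffAt_map_inverse (n := ∞)).contMDiffAt.comp x₀
    (hs x₀)).congr_of_eventuallyEq ?_
  filter_upwards [key] with x hx
  exact (ContinuousLinearMap.inverse_eq hx.2 hx.1).symm

/-- The section constant in a trivialization around x is multiplied by a bump function supported in
its base set. -/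
theorem exists_isSmooth_apply_eq [FiniteDimensional ℝ E] [T2Space M] [IsManifold 𝓘(ℝ, E) ∞ M]
    [ContMDiffVectorBundle ∞ F₁ V₁ 𝓘(ℝ, E)] (x : M) (v : V₁ x) :
    ∃ s : ∀ x, V₁ x, IsSmooth E F₁ s ∧ s x = v := by
  let e := trivializationAt F₁ V₁ x
  have hx : x ∈ e.baseSet := FiberBundle.mem_baseSet_trivializationAt' x
  obtain ⟨f, -, hf⟩ := (SmoothBumpFunction.nhds_basis_tsupport (I := 𝓘(ℝ, E)) x).mem_iff.1
    (e.open_baseSet.mem_nhds hx)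
  let w := (e ⟨x, v⟩).2
  have hs : ContMDiffOn 𝓘(ℝ, E) (𝓘(ℝ, E).prod 𝓘(ℝ, F₁)) ∞
      (fun z ↦ TotalSpace.mk' F₁ z (e.symm z w)) e.baseSet := by
    have h1 : ContMDiffOn 𝓘(ℝ, E) (𝓘(ℝ, E).prod 𝓘(ℝ, F₁)) ∞ (fun z : M ↦ (z, w)) e.baseSet :=
      contMDiffOn_id.prodMk contMDiffOn_const
    refine ((Trivialization.contMDiffOn_symm (IB := 𝓘(ℝ, E)) (n := ∞) e).comp h1
      (fun z hz ↦ e.mem_target.2 hz)).congr fun z hz ↦ ?_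
    exact e.mk_symm hz w
  refine ⟨(f : M → ℝ) • fun z ↦ e.symm z w,
    ContMDiffOn.smul_section_of_tsupport f.contMDiff.contMDiffOn e.open_baseSet hf hs, ?_⟩
  rw [Pi.smul_apply', f.eq_one, one_smul]
  exact e.symm_apply_apply_mk hx v

end Sections

/-! ### Courant and Schouten brackets through 1-jets in a chart -/

section Courant

open Bundle Filter Topology

variable {E : Type*} [NormedAddCommGroup E] [NormedSpace ℝ E]
  {M : Type*} [TopologicalSpace M] [ChartedSpace E M] [IsManifold 𝓘(ℝ, E) ∞ M]

/-- The derivative at `x` of a vector field, in the preferred chart at `x`. -/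
def vectorDeriv (X : ∀ x : M, Tan E x) (x : M) : E →L[ℝ] E :=
  fderiv ℝ (vectorInChart X x) (extChartAt 𝓘(ℝ, E) x x)

/-- The derivative at `x` of a `1`-form, in the preferred chart at `x`. -/
def formDeriv (η : ∀ x : M, Cot E x) (x : M) : E →L[ℝ] E →L[ℝ] ℝ :=
  fderiv ℝ (formInChart η x) (extChartAt 𝓘(ℝ, E) x x)

set_option synthInstance.maxHeartbeats 200000 in
/-- The derivative at `x` of a bivector field, in the preferred chart at `x`. -/
def bivectorDeriv (P : ∀ x : M, Cot E x →L[ℝ] Tan E x) (x : M) :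
    E →L[ℝ] (E →L[ℝ] ℝ) →L[ℝ] E :=
  fderiv ℝ (bivectorInChart P x) (extChartAt 𝓘(ℝ, E) x x)

theorem hasFDerivAt_vectorInChart {X : ∀ x : M, Tan E x} (hX : IsSmooth E E X) (x : M) :
    HasFDerivAt (vectorInChart X x) (vectorDeriv X x) (extChartAt 𝓘(ℝ, E) x x) :=
  (differentiableAt_vectorInChart hX x).hasFDerivAt

theorem hasFDerivAt_formInChart {η : ∀ x : M, Cot E x} (hη : IsSmooth E (E →L[ℝ] ℝ) η) (x : M) :
    HasFDerivAt (formInChart η x) (formDeriv η x) (extChartAt 𝓘(ℝ, E) x x) :=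
  (differentiableAt_formInChart hη x).hasFDerivAt

set_option synthInstance.maxHeartbeats 200000 in
theorem hasFDerivAt_bivectorInChart {P : ∀ x : M, Cot E x →L[ℝ] Tan E x}
    (hP : IsSmooth E ((E →L[ℝ] ℝ) →L[ℝ] E) P) (x : M) :
    HasFDerivAt (bivectorInChart P x) (bivectorDeriv P x) (extChartAt 𝓘(ℝ, E) x x) :=
  (differentiableAt_bivectorInChart hP x).hasFDerivAt

set_option synthInstance.maxHeartbeats 200000 in
-- In a chart, skewness is a linear condition with constant coefficients, so it can be
-- differentiated.
theorem bivectorDeriv_skew {P : ∀ x : M, Cot E x →L[ℝ] Tan E x}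
    (hP : IsSmooth E ((E →L[ℝ] ℝ) →L[ℝ] E) P)
    (hskew : ∀ (x : M) (α β : Cot E x), β (P x α) = -α (P x β)) (x : M) (w : E)
    (a b : E →L[ℝ] ℝ) : b (bivectorDeriv P x w a) = -a (bivectorDeriv P x w b) := by
  have h := hasFDerivAt_bivectorInChart hP x
  have h1 : ∀ a b : E →L[ℝ] ℝ, HasFDerivAt (fun y ↦ b (bivectorInChart P x y a))
      (b.comp ((bivectorDeriv P x).flip a)) (extChartAt 𝓘(ℝ, E) x x) := fun a b ↦ by
    refine (b.hasFDerivAt.comp _ (h.clm_apply (hasFDerivAt_const a _))).congr_fderiv ?_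
    ext w
    simp
  have h2 := (h1 b a).neg
  have h3 : (fun y ↦ b (bivectorInChart P x y a)) = -fun y ↦ a (bivectorInChart P x y b) :=
    funext fun y ↦ bivectorInChart_skew hskew x y a b
  exact DFunLike.congr_fun ((h1 a b).unique (h3 ▸ h2)) w

theorem contMDiff_pairing {η : ∀ x : M, Cot E x} {X : ∀ x : M, Tan E x}
    (hη : IsSmooth E (E →L[ℝ] ℝ) η) (hX : IsSmooth E E X) :
    ContMDiff 𝓘(ℝ, E) 𝓘(ℝ, ℝ) ∞ (fun z ↦ (η z (X z) : ℝ)) := fun x ↦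
  (contMDiffAt_section x).1 (ContMDiff.clm_bundle_apply hη hX x)

theorem dFun_pairing {η : ∀ x : M, Cot E x} {X : ∀ x : M, Tan E x}
    (hη : IsSmooth E (E →L[ℝ] ℝ) η) (hX : IsSmooth E E X) (x : M) (w : E) :
    (dFun (fun z ↦ (η z (X z) : ℝ)) x : E →L[ℝ] ℝ) w =
      formDeriv η x w (X x) + (η x : E →L[ℝ] ℝ) (vectorDeriv X x w) := by
  rw [dFun_eq ((contMDiff_pairing hη hX).mdifferentiableAt (by simp))]
  have h := (hasFDerivAt_formInChart hη x).clm_apply (hasFDerivAt_vectorInChart hX x)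
  have h2 : (fun y ↦ (η ((extChartAt 𝓘(ℝ, E) x).symm y) (X ((extChartAt 𝓘(ℝ, E) x).symm y)) : ℝ))
      =ᶠ[𝓝 (extChartAt 𝓘(ℝ, E) x x)] fun y ↦ formInChart η x y (vectorInChart X x y) := by
    filter_upwards [eventually_mem_target x] with y hy
    exact (formInChart_apply_vectorInChart η X hy).symm
  rw [(h.congr_of_eventuallyEq h2).fderiv]
  have h3 : vectorInChart X x (extChartAt 𝓘(ℝ, E) x x) = X x := vectorInChart_self X x
  have h4 : formInChart η x (extChartAt 𝓘(ℝ, E) x x) = η x := formInChart_self η x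
  change formInChart η x _ (vectorDeriv X x w) + formDeriv η x w (vectorInChart X x _) = _
  rw [h3, h4, add_comm]
  rfl

theorem courant_fst (u v : ∀ x : M, GTan E x) (x : M) :
    ((courant u v x).1 : E) = vectorDeriv (fun z ↦ (v z).1) x (u x).1 -
      vectorDeriv (fun z ↦ (u z).1) x (v x).1 :=
  mlieBracket_eq _ _ x

theorem courant_snd {u v : ∀ x : M, GTan E x} (hu₁ : IsSmooth E E (fun x ↦ (u x).1))
    (hu₂ : IsSmooth E (E →L[ℝ] ℝ) (fun x ↦ (u x).2)) (hv₁ : IsSmooth E E (fun x ↦ (v x).1))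
    (hv₂ : IsSmooth E (E →L[ℝ] ℝ) (fun x ↦ (v x).2)) (x : M) (w : E) :
    ((courant u v x).2 : E →L[ℝ] ℝ) w =
      courantForm (E := E) (u x).1 (vectorDeriv (fun z ↦ (u z).1) x) (u x).2
        (formDeriv (fun z ↦ (u z).2) x) (v x).1 (vectorDeriv (fun z ↦ (v z).1) x) (v x).2
        (formDeriv (fun z ↦ (v z).2) x) w := by
  have hsub : (dFun (fun z ↦ (v z).2 (u z).1 - (u z).2 (v z).1) x : E →L[ℝ] ℝ) w =
      (dFun (fun z ↦ ((v z).2 (u z).1 : ℝ)) x : E →L[ℝ] ℝ) w -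
        (dFun (fun z ↦ ((u z).2 (v z).1 : ℝ)) x : E →L[ℝ] ℝ) w :=
    DFunLike.congr_fun (mfderiv_sub ((contMDiff_pairing hv₂ hu₁).mdifferentiableAt (by simp))
      ((contMDiff_pairing hu₂ hv₁).mdifferentiableAt (by simp))) w
  have hlie : ∀ (X : ∀ x : M, Tan E x) (η : ∀ x : M, Cot E x), (lieForm X η x : E →L[ℝ] ℝ) w =
      formDeriv η x (X x) w - formDeriv η x w (X x) +
        (dFun (fun z ↦ (η z (X z) : ℝ)) x : E →L[ℝ] ℝ) w := fun X η ↦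
    congrArg (· + (dFun (fun z ↦ (η z (X z) : ℝ)) x : E →L[ℝ] ℝ) w) (contractD_apply X η x w)
  have h : ((courant u v x).2 : E →L[ℝ] ℝ) w =
      (lieForm (fun z ↦ (u z).1) (fun z ↦ (v z).2) x : E →L[ℝ] ℝ) w
      - (lieForm (fun z ↦ (v z).1) (fun z ↦ (u z).2) x : E →L[ℝ] ℝ) w
      - (1 / 2 : ℝ) * 
          (dFun (fun z ↦ (v z).2 (u z).1 - (u z).2 (v z).1) x : E →L[ℝ] ℝ) w := rfl
  rw [h, hsub, hlie, hlie, dFun_pairing hv₂ hu₁, dFun_pairing hu₂ hv₁]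
  -- The exact parts of the two Lie derivatives make up d(ι_X η - ι_Y ξ), of which the last term of
  -- the bracket removes half. This is the ½ in `courantForm`.
  have aux : ∀ a b c d e f : ℝ, a - b + (b + e) - (c - d + (d + f)) -
      (1 / 2 : ℝ) * (b + e - (d + f)) = a - b - (c - d) + (1 / 2 : ℝ) * (b + e - (d + f)) := by
    intros
    ring
  exact aux _ _ _ _ _ _

theorem schouten_eq_schoutenSum (P Q : ∀ x : M, Cot E x →L[ℝ] Tan E x) (x : M)
    (α β γ : Cot E x) : schouten P Q x α β γ =
      schoutenSum (E := E) (P x) (Q x) (bivectorDeriv P x) (bivectorDeriv Q x) α β γ := by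
  have h : (mfderiv 𝓘(ℝ, E) 𝓘(ℝ, E) (extChartAt 𝓘(ℝ, E) x) x : E →L[ℝ] E).inverse =
      ContinuousLinearMap.id ℝ E := by
    rw [← ContinuousLinearMap.inverse_id]
    exact congrArg _ mfderiv_extChartAt_self
  have h2 : ∀ T : E →L[ℝ] E, T = ContinuousLinearMap.id ℝ E → ∀ a : Cot E x,
      (a : E →L[ℝ] ℝ).comp T = a := by
    rintro T rfl a
    rfl
  have h3 := h2 _ h
  have hP : (bivectorInChart P x (extChartAt 𝓘(ℝ, E) x x) : (E →L[ℝ] ℝ) →L[ℝ] E) = P x :=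
    bivectorInChart_self P x
  have hQ : (bivectorInChart Q x (extChartAt 𝓘(ℝ, E) x x) : (E →L[ℝ] ℝ) →L[ℝ] E) = Q x :=
    bivectorInChart_self Q x
  have key : schouten P Q x α β γ = schoutenSum (E := E)
      (bivectorInChart P x (extChartAt 𝓘(ℝ, E) x x)) (bivectorInChart Q x (extChartAt 𝓘(ℝ, E) x x))
      (bivectorDeriv P x) (bivectorDeriv Q x)
      ((α : E →L[ℝ] ℝ).comp
        (mfderiv 𝓘(ℝ, E) 𝓘(ℝ, E) (extChartAt 𝓘(ℝ, E) x) x : E →L[ℝ] E).inverse)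
      ((β : E →L[ℝ] ℝ).comp
        (mfderiv 𝓘(ℝ, E) 𝓘(ℝ, E) (extChartAt 𝓘(ℝ, E) x) x : E →L[ℝ] E).inverse)
      ((γ : E →L[ℝ] ℝ).comp
        (mfderiv 𝓘(ℝ, E) 𝓘(ℝ, E) (extChartAt 𝓘(ℝ, E) x) x : E →L[ℝ] E).inverse) := rfl
  rw [key, hP, hQ, h3, h3, h3]

end Courant

/-! ### Courant brackets of sections of the graph of P + iεQ -/

section Graph

open Bundle Filter Topology

variable {E : Type*} [NormedAddCommGroup E] [NormedSpace ℝ E]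
  {M : Type*} [TopologicalSpace M] [ChartedSpace E M] [IsManifold 𝓘(ℝ, E) ∞ M]

set_option synthInstance.maxHeartbeats 200000

/-- This is the product rule in the chart. The values p, q, a, a' enter through equations so that
the conclusion lives in E and its dual rather than in the fibres at x. -/
theorem vectorDeriv_apply_add_smul {P Q : ∀ x : M, Cot E x →L[ℝ] Tan E x}
    (hP : IsSmooth E ((E →L[ℝ] ℝ) →L[ℝ] E) P) (hQ : IsSmooth E ((E →L[ℝ] ℝ) →L[ℝ] E) Q)
    {ξ ξ' : ∀ x : M, Cot E x} (hξ : IsSmooth E (E →L[ℝ] ℝ) ξ) (hξ' : IsSmooth E (E →L[ℝ] ℝ) ξ')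
    (ε : ℝ) {X : ∀ x : M, Tan E x} (hX : ∀ x, X x = P x (ξ x) + ε • Q x (ξ' x)) (x : M)
    {p q : (E →L[ℝ] ℝ) →L[ℝ] E} (hp : P x = p) (hq : Q x = q) {a a' : E →L[ℝ] ℝ}
    (ha : ξ x = a) (ha' : ξ' x = a') (w : E) :
    vectorDeriv X x w = bivectorDeriv P x w a + p (formDeriv ξ x w) +
      ε • (bivectorDeriv Q x w a' + q (formDeriv ξ' x w)) := by
  have h1 := (hasFDerivAt_bivectorInChart hP x).clm_apply (hasFDerivAt_formInChart hξ x)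
  have h2 := (hasFDerivAt_bivectorInChart hQ x).clm_apply (hasFDerivAt_formInChart hξ' x)
  have h3 : vectorInChart X x =ᶠ[𝓝 (extChartAt 𝓘(ℝ, E) x x)]
      fun y ↦ bivectorInChart P x y (formInChart ξ x y) +
        ε • bivectorInChart Q x y (formInChart ξ' x y) := by
    filter_upwards [eventually_mem_target x] with y hy
    rw [bivectorInChart_apply_formInChart P ξ hy, bivectorInChart_apply_formInChart Q ξ' hy]
    simp only [vectorInChart]
    rw [hX, map_add, map_smul]
  have e1 := (bivectorInChart_self P x).trans hp
  have e2 := (bivectorInChart_self Q x).trans hq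
  have e3 := (formInChart_self ξ x).trans ha
  have e4 := (formInChart_self ξ' x).trans ha'
  have h4 := ((h1.add (h2.const_smul ε)).congr_of_eventuallyEq h3).fderiv
  rw [e1, e2, e3, e4] at h4
  refine (DFunLike.congr_fun h4 w).trans ?_
  simp [add_comm]

section Scaling

variable {p q : (E →L[ℝ] ℝ) →L[ℝ] E} {Dp Dq : E →L[ℝ] (E →L[ℝ] ℝ) →L[ℝ] E}

theorem schoutenSum_smul_left (ε : ℝ) (a b c : E →L[ℝ] ℝ) :
    schoutenSum (ε • q) p (ε • Dq) Dp a b c = ε * schoutenSum q p Dq Dp a b c := by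
  simp only [schoutenSum, schoutenTerm, smul_apply, map_smul, smul_eq_mul]
  ring

theorem schoutenSum_smul_smul {ε : ℝ} (hε : ε * ε = 1) (a b c : E →L[ℝ] ℝ) :
    schoutenSum (ε • q) (ε • q) (ε • Dq) (ε • Dq) a b c = schoutenSum q q Dq Dq a b c := by
  rw [← one_mul (schoutenSum q q Dq Dq a b c), ← hε]
  simp only [schoutenSum, schoutenTerm, smul_apply, map_smul, smul_eq_mul]
  ring

/-- Both eigenvalues are treated at once by replacing q with εq: the bracket of q with itself is
unchanged because ε² = 1, while the mixed bracket acquires the factor ε. -/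
theorem graph_smul_re {ε : ℝ} (hε : ε * ε = 1)
    (hp : ∀ a b : E →L[ℝ] ℝ, b (p a) = -a (p b))
    (hq : ∀ a b : E →L[ℝ] ℝ, b (q a) = -a (q b))
    (hDp : ∀ w, ∀ a b : E →L[ℝ] ℝ, b (Dp w a) = -a (Dp w b))
    (hDq : ∀ w, ∀ a b : E →L[ℝ] ℝ, b (Dq w a) = -a (Dq w b))
    {ξ ξ' η η' : E →L[ℝ] ℝ} (c : E →L[ℝ] ℝ) {Dξ Dξ' Dη Dη' : E →L[ℝ] E →L[ℝ] ℝ}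
    {X X' Y Y' : E} {DX DX' DY DY' : E →L[ℝ] E}
    (hX : X = p ξ - ε • q ξ') (hX' : X' = p ξ' + ε • q ξ)
    (hY : Y = p η - ε • q η') (hY' : Y' = p η' + ε • q η)
    (hDX : ∀ w, DX w = Dp w ξ + p (Dξ w) + (-ε) • (Dq w ξ' + q (Dξ' w)))
    (hDX' : ∀ w, DX' w = Dp w ξ' + p (Dξ' w) + ε • (Dq w ξ + q (Dξ w)))
    (hDY : ∀ w, DY w = Dp w η + p (Dη w) + (-ε) • (Dq w η' + q (Dη' w)))
    (hDY' : ∀ w, DY' w = Dp w η' + p (Dη' w) + ε • (Dq w η + q (Dη w))) :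
    c ((DY X - DX Y) - (DY' X' - DX' Y'))
      + (courantForm X DX ξ Dξ Y DY η Dη (p c) - courantForm X' DX' ξ' Dξ' Y' DY' η' Dη' (p c))
      - (courantForm X DX ξ Dξ Y' DY' η' Dη' (ε • q c)
        + courantForm X' DX' ξ' Dξ' Y DY η Dη (ε • q c)) =
    (1 / 2 : ℝ) * (schoutenSum p p Dp Dp ξ η c - schoutenSum q q Dq Dq ξ η c)
     - (1 / 2 : ℝ) * (schoutenSum p p Dp Dp ξ' η' c - schoutenSum q q Dq Dq ξ' η' c)
     - ε * schoutenSum q p Dq Dp ξ η' c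
     - ε * schoutenSum q p Dq Dp ξ' η c := by
  have h := graph_re (q := ε • q) (Dq := ε • Dq) hp
    (fun a b ↦ by simp only [smul_apply, map_smul, hq a b, smul_neg]) hDp
    (fun w a b ↦ by simp only [smul_apply, map_smul, hDq w a b, smul_neg])
    ξ ξ' η η' c Dξ Dξ' Dη Dη' X X' Y Y' DX DX' DY DY' hX hX' hY hY'
    (fun w ↦ by simp only [hDX, smul_apply, neg_smul, smul_add, sub_eq_add_neg, neg_add])
    (fun w ↦ by simp only [hDX', smul_apply, smul_add])
    (fun w ↦ by simp only [hDY, smul_apply, neg_smul, smul_add, sub_eq_add_neg, neg_add])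
    (fun w ↦ by simp only [hDY', smul_apply, smul_add])
  simp only [schoutenSum_smul_left, schoutenSum_smul_smul hε] at h
  exact h

theorem graph_smul_im {ε : ℝ} (hε : ε * ε = 1)
    (hp : ∀ a b : E →L[ℝ] ℝ, b (p a) = -a (p b))
    (hq : ∀ a b : E →L[ℝ] ℝ, b (q a) = -a (q b))
    (hDp : ∀ w, ∀ a b : E →L[ℝ] ℝ, b (Dp w a) = -a (Dp w b))
    (hDq : ∀ w, ∀ a b : E →L[ℝ] ℝ, b (Dq w a) = -a (Dq w b))
    {ξ ξ' η η' : E →L[ℝ] ℝ} (c : E →L[ℝ] ℝ) {Dξ Dξ' Dη Dη' : E →L[ℝ] E →L[ℝ] ℝ}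
    {X X' Y Y' : E} {DX DX' DY DY' : E →L[ℝ] E}
    (hX : X = p ξ - ε • q ξ') (hX' : X' = p ξ' + ε • q ξ)
    (hY : Y = p η - ε • q η') (hY' : Y' = p η' + ε • q η)
    (hDX : ∀ w, DX w = Dp w ξ + p (Dξ w) + (-ε) • (Dq w ξ' + q (Dξ' w)))
    (hDX' : ∀ w, DX' w = Dp w ξ' + p (Dξ' w) + ε • (Dq w ξ + q (Dξ w)))
    (hDY : ∀ w, DY w = Dp w η + p (Dη w) + (-ε) • (Dq w η' + q (Dη' w)))
    (hDY' : ∀ w, DY' w = Dp w η' + p (Dη' w) + ε • (Dq w η + q (Dη w))) :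
    c ((DY' X - DX Y') + (DY X' - DX' Y))
      + (courantForm X DX ξ Dξ Y' DY' η' Dη' (p c) + courantForm X' DX' ξ' Dξ' Y DY η Dη (p c))
      + (courantForm X DX ξ Dξ Y DY η Dη (ε • q c)
        - courantForm X' DX' ξ' Dξ' Y' DY' η' Dη' (ε • q c)) =
    (1 / 2 : ℝ) * (schoutenSum p p Dp Dp ξ η' c - schoutenSum q q Dq Dq ξ η' c)
     + (1 / 2 : ℝ) * (schoutenSum p p Dp Dp ξ' η c - schoutenSum q q Dq Dq ξ' η c)
     + ε * schoutenSum q p Dq Dp ξ η c - ε * schoutenSum q p Dq Dp ξ' η' c := by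
  have h := graph_im (q := ε • q) (Dq := ε • Dq) hp
    (fun a b ↦ by simp only [smul_apply, map_smul, hq a b, smul_neg]) hDp
    (fun w a b ↦ by simp only [smul_apply, map_smul, hDq w a b, smul_neg])
    ξ ξ' η η' c Dξ Dξ' Dη Dη' X X' Y Y' DX DX' DY DY' hX hX' hY hY'
    (fun w ↦ by simp only [hDX, smul_apply, neg_smul, smul_add, sub_eq_add_neg, neg_add])
    (fun w ↦ by simp only [hDX', smul_apply, smul_add])
    (fun w ↦ by simp only [hDY, smul_apply, neg_smul, smul_add, sub_eq_add_neg, neg_add])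
    (fun w ↦ by simp only [hDY', smul_apply, smul_add])
  simp only [schoutenSum_smul_left, schoutenSum_smul_smul hε] at h
  exact h

end Scaling

/-- The vector `a + ib` lies in the graph of the complex bivector field `P + iεQ`. -/
def IsGraph (P Q : ∀ x : M, Cot E x →L[ℝ] Tan E x) (ε : ℝ) (x : M) (a b : GTan E x) : Prop :=
  a.1 = P x a.2 - ε • Q x b.2 ∧ b.1 = P x b.2 + ε • Q x a.2

variable {P Q : ∀ x : M, Cot E x →L[ℝ] Tan E x}

/-- The Courant bracket of two sections of the graph of `P + iεQ` deviates from the graph by the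
Schouten bracket of `P + iεQ` with itself. -/
theorem courant_graph
    (hP : IsSmooth E ((E →L[ℝ] ℝ) →L[ℝ] E) P) (hQ : IsSmooth E ((E →L[ℝ] ℝ) →L[ℝ] E) Q)
    (hPs : ∀ (x : M) (α β : Cot E x), β (P x α) = -α (P x β))
    (hQs : ∀ (x : M) (α β : Cot E x), β (Q x α) = -α (Q x β)) {ε : ℝ} (hε : ε * ε = 1)
    {u v : CSection E M} (hu : ∀ x, IsGraph P Q ε x (u.re x) (u.im x))
    (hv : ∀ x, IsGraph P Q ε x (v.re x) (v.im x)) (x : M) (γ : Cot E x) :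
    let a := courant u.re v.re x - courant u.im v.im x
    let b := courant u.re v.im x + courant u.im v.re x
    γ (a.1 - (P x a.2 - ε • Q x b.2)) =
      (1 / 2 : ℝ) * (schouten P P x (u.re x).2 (v.re x).2 γ - schouten Q Q x (u.re x).2 (v.re x).2 γ)
      - (1 / 2 : ℝ) * (schouten P P x (u.im x).2 (v.im x).2 γ
          - schouten Q Q x (u.im x).2 (v.im x).2 γ)
      - ε * schouten Q P x (u.re x).2 (v.im x).2 γ - ε * schouten Q P x (u.im x).2 (v.re x).2 γ ∧
    γ (b.1 - (P x b.2 + ε • Q x a.2)) =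
      (1 / 2 : ℝ) * (schouten P P x (u.re x).2 (v.im x).2 γ - schouten Q Q x (u.re x).2 (v.im x).2 γ)
      + (1 / 2 : ℝ) * (schouten P P x (u.im x).2 (v.re x).2 γ
          - schouten Q Q x (u.im x).2 (v.re x).2 γ)
      + ε * schouten Q P x (u.re x).2 (v.re x).2 γ - ε * schouten Q P x (u.im x).2 (v.im x).2 γ := by
  intro a b
  have hre := fun (u : CSection E M) (hu : ∀ x, IsGraph P Q ε x (u.re x) (u.im x)) ↦
    vectorDeriv_apply_add_smul hP hQ u.smooth_re_snd u.smooth_im_snd (-ε)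
    (X := fun z ↦ (u.re z).1) (fun z ↦ by rw [(hu z).1, neg_smul, sub_eq_add_neg]) x rfl rfl rfl rfl
  have him := fun (u : CSection E M) (hu : ∀ x, IsGraph P Q ε x (u.re x) (u.im x)) ↦
    vectorDeriv_apply_add_smul hP hQ u.smooth_im_snd u.smooth_re_snd ε
    (X := fun z ↦ (u.im z).1) (fun z ↦ (hu z).2) x rfl rfl rfl rfl
  have hDp := bivectorDeriv_skew hP hPs x
  have hDq := bivectorDeriv_skew hQ hQs x
  have main_re := graph_smul_re (E := E) hε (hPs x) (hQs x) hDp hDq γ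
    (hu x).1 (hu x).2 (hv x).1 (hv x).2 (hre u hu) (him u hu) (hre v hv) (him v hv)
  have main_im := graph_smul_im (E := E) hε (hPs x) (hQs x) hDp hDq γ
    (hu x).1 (hu x).2 (hv x).1 (hv x).2 (hre u hu) (him u hu) (hre v hv) (him v hv)
  have hrr := courant_snd u.smooth_re_fst u.smooth_re_snd v.smooth_re_fst v.smooth_re_snd x
  have hri := courant_snd u.smooth_re_fst u.smooth_re_snd v.smooth_im_fst v.smooth_im_snd x
  have hir := courant_snd u.smooth_im_fst u.smooth_im_snd v.smooth_re_fst v.smooth_re_snd x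
  have hii := courant_snd u.smooth_im_fst u.smooth_im_snd v.smooth_im_fst v.smooth_im_snd x
  have hP' : ∀ α : Cot E x, γ (P x α) = -α (P x γ) := fun α ↦ hPs x α γ
  have hQ' : ∀ α : Cot E x, γ (ε • Q x α) = -α (ε • Q x γ) := fun α ↦ by
    rw [map_smul, map_smul, hQs x α γ, smul_neg]
  -- By skewness the deviation evaluated on γ is twice the inner product of the bracket with the
  -- graph vector over γ, that is (Pγ + iεQγ) + γ. This is its real part, and the next identity its
  -- imaginary part.
  have hre' : γ (a.1 - (P x a.2 - ε • Q x b.2)) = γ a.1 + a.2 (P x γ) - b.2 (ε • Q x γ) := by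
    rw [map_sub, map_sub, hP', hQ']
    ring
  have him' : γ (b.1 - (P x b.2 + ε • Q x a.2)) = γ b.1 + b.2 (P x γ) + a.2 (ε • Q x γ) := by
    rw [map_sub, map_add, hP', hQ']
    ring
  simp only [schouten_eq_schoutenSum]
  constructor
  · exact hre'.trans ((congrArg₂ (fun s t : ℝ ↦ s - t) (congrArg₂ (fun s t : ℝ ↦ s + t)
      (congrArg (γ : E →L[ℝ] ℝ) (congrArg₂ (fun s t : E ↦ s - t) (courant_fst u.re v.re x)
        (courant_fst u.im v.im x)))
      (congrArg₂ (fun s t : ℝ ↦ s - t) (hrr _) (hii _)))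
      (congrArg₂ (fun s t : ℝ ↦ s + t) (hri _) (hir _))).trans main_re)
  · exact him'.trans ((congrArg₂ (fun s t : ℝ ↦ s + t) (congrArg₂ (fun s t : ℝ ↦ s + t)
      (congrArg (γ : E →L[ℝ] ℝ) (congrArg₂ (fun s t : E ↦ s + t) (courant_fst u.re v.im x)
        (courant_fst u.im v.re x)))
      (congrArg₂ (fun s t : ℝ ↦ s + t) (hri _) (hir _)))
      (congrArg₂ (fun s t : ℝ ↦ s - t) (hrr _) (hii _))).trans main_im)

end Graph

/-! ### Integrability of J as equations for π + iP -/

section Integrability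

variable {E : Type*} [NormedAddCommGroup E] [NormedSpace ℝ E]
  {M : Type*} [TopologicalSpace M] [ChartedSpace E M]

theorem tangent_eq_zero {x : M} {v : Tan E x} (h : ∀ γ : Cot E x, γ v = 0) : v = 0 :=
  SeparatingDual.eq_zero_of_forall_dual_eq_zero (R := ℝ) (V := E) h

/-- The endomorphism `J` has the blocks `A = π P⁻¹`, `π_A = -(1 + A²) P`, `σ = P⁻¹` and
`-A^* = -P⁻¹ π`. -/
structure HasHitchinBlocks (J : ∀ x : M, GTan E x →L[ℝ] GTan E x)
    (π P : ∀ x : M, Cot E x →L[ℝ] Tan E x) : Prop where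
  isInvertible : ∀ x, (P x).IsInvertible
  apply_eq : ∀ x X ξ, J x (X, ξ) =
    (π x ((P x).inverse X) - (P x ξ + π x ((P x).inverse (π x ξ))),
      (P x).inverse X - (P x).inverse (π x ξ))

variable {J : ∀ x : M, GTan E x →L[ℝ] GTan E x} {π P : ∀ x : M, Cot E x →L[ℝ] Tan E x}

/-- Applying P to the T^*-component of the eigenvalue equation solves for the vector part. On the
graph the T-component then follows from (Im l)² = 1. -/
theorem HasHitchinBlocks.isEigen_iff (h : HasHitchinBlocks J π P) {l : ℂ} (hre : l.re = 0)
    (him : l.im * l.im = 1) (x : M) (a b : GTan E x) :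
    IsEigen J l x a b ↔ IsGraph π P l.im x a b := by
  have hσP : ∀ ξ, (P x).inverse (P x ξ) = ξ := (h.isInvertible x).inverse_apply_self
  have hPσ : ∀ X, P x ((P x).inverse X) = X := (h.isInvertible x).self_apply_inverse
  obtain ⟨X, ξ⟩ := a
  obtain ⟨X', ξ'⟩ := b
  have hsm : ∀ v : Tan E x, l.im • l.im • v = v := fun v ↦ by rw [smul_smul, him, one_smul]
  simp only [IsEigen, IsGraph, hre, zero_smul, zero_sub, add_zero, h.apply_eq, Prod.ext_iff,
    Prod.fst_neg, Prod.snd_neg, Prod.smul_fst, Prod.smul_snd]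
  constructor
  · rintro ⟨⟨-, h1⟩, ⟨-, h2⟩⟩
    have h1' := congrArg (P x) h1
    have h2' := congrArg (P x) h2
    simp only [map_sub, hPσ, map_neg, map_smul] at h1' h2'
    exact ⟨by rw [sub_eq_iff_eq_add.1 h1']; abel, by rw [sub_eq_iff_eq_add.1 h2']; abel⟩
  · rintro ⟨rfl, rfl⟩
    refine ⟨⟨?_, ?_⟩, ⟨?_, ?_⟩⟩ <;>
    simp only [map_sub, map_add, map_smul, hσP, smul_add, smul_sub, hsm] <;> abel

variable [IsManifold 𝓘(ℝ, E) ∞ M]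

set_option synthInstance.maxHeartbeats 200000

theorem schouten_zero_left (P Q : ∀ x : M, Cot E x →L[ℝ] Tan E x) (x : M) (β γ : Cot E x) :
    schouten P Q x 0 β γ = 0 := by
  rw [schouten_eq_schoutenSum]
  have h : ∀ (p q : (E →L[ℝ] ℝ) →L[ℝ] E) (Dp Dq : E →L[ℝ] (E →L[ℝ] ℝ) →L[ℝ] E)
      (b c : E →L[ℝ] ℝ), schoutenSum p q Dp Dq 0 b c = 0 := by
    intros
    simp [schoutenSum, schoutenTerm]
  exact h _ _ _ _ _ _

theorem schouten_zero_middle (P Q : ∀ x : M, Cot E x →L[ℝ] Tan E x) (x : M) (α γ : Cot E x) :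
    schouten P Q x α 0 γ = 0 := by
  rw [schouten_eq_schoutenSum]
  have h : ∀ (p q : (E →L[ℝ] ℝ) →L[ℝ] E) (Dp Dq : E →L[ℝ] (E →L[ℝ] ℝ) →L[ℝ] E)
      (a c : E →L[ℝ] ℝ), schoutenSum p q Dp Dq a 0 c = 0 := by
    intros
    simp [schoutenSum, schoutenTerm]
  exact h _ _ _ _ _ _

/-- The Schouten equations kill every term of the deviation in `courant_graph`, and covectors
separate tangent vectors. -/
theorem HasHitchinBlocks.closedUnderCourant (h : HasHitchinBlocks J π P)
    (hπ : IsSmooth E ((E →L[ℝ] ℝ) →L[ℝ] E) π) (hP : IsSmooth E ((E →L[ℝ] ℝ) →L[ℝ] E) P)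
    (hπs : ∀ (x : M) (α β : Cot E x), β (π x α) = -α (π x β))
    (hPs : ∀ (x : M) (α β : Cot E x), β (P x α) = -α (P x β))
    {l : ℂ} (hre : l.re = 0) (him : l.im * l.im = 1)
    (h₁ : ∀ x, schouten P P x = schouten π π x) (h₂ : ∀ x, schouten P π x = 0) :
    ClosedUnderCourant J l := by
  intro u v hu hv x
  rw [h.isEigen_iff hre him]
  have key := courant_graph hπ hP hπs hPs him (fun x ↦ (h.isEigen_iff hre him x _ _).1 (hu x))
    (fun x ↦ (h.isEigen_iff hre him x _ _).1 (hv x)) x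
  simp only [h₁, h₂, sub_self, mul_zero, Pi.zero_apply, add_zero] at key
  exact ⟨sub_eq_zero.1 (tangent_eq_zero fun γ ↦ (key γ).1),
    sub_eq_zero.1 (tangent_eq_zero fun γ ↦ (key γ).2)⟩

/-- The section of the graph of `π + iεP` over the real `1`-form `ξ`. -/
def graphSection (hπ : IsSmooth E ((E →L[ℝ] ℝ) →L[ℝ] E) π)
    (hP : IsSmooth E ((E →L[ℝ] ℝ) →L[ℝ] E) P) (ε : ℝ) {ξ : ∀ x : M, Cot E x}
    (hξ : IsSmooth E (E →L[ℝ] ℝ) ξ) : CSection E M where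
  re x := (π x (ξ x), ξ x)
  im x := (ε • P x (ξ x), 0)
  smooth_re_fst := ContMDiff.clm_bundle_apply hπ hξ
  smooth_re_snd := hξ
  smooth_im_fst := ContMDiff.const_smul_section (ContMDiff.clm_bundle_apply hP hξ)
  smooth_im_snd := Bundle.contMDiff_zeroSection ℝ _

/-- Graph sections over real forms suffice as tests: the deviation then has real part ½([π, π] - [P,
P]) and imaginary part (Im l)[P, π]. Only the values of the forms at x enter, so any smooth
extension of the given covectors serves. -/
theorem HasHitchinBlocks.schouten_eq [FiniteDimensional ℝ E] [T2Space M]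
    (h : HasHitchinBlocks J π P)
    (hπ : IsSmooth E ((E →L[ℝ] ℝ) →L[ℝ] E) π) (hP : IsSmooth E ((E →L[ℝ] ℝ) →L[ℝ] E) P)
    (hπs : ∀ (x : M) (α β : Cot E x), β (π x α) = -α (π x β))
    (hPs : ∀ (x : M) (α β : Cot E x), β (P x α) = -α (P x β))
    {l : ℂ} (hre : l.re = 0) (him : l.im * l.im = 1) (hJ : ClosedUnderCourant J l) (x : M) :
    schouten P P x = schouten π π x ∧ schouten P π x = 0 := by
  have hl : l.im ≠ 0 := fun h0 ↦ by simp [h0] at him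
  have hgraph : ∀ {ξ : ∀ x : M, Cot E x} (hξ : IsSmooth E (E →L[ℝ] ℝ) ξ) x,
      IsGraph π P l.im x ((graphSection hπ hP l.im hξ).re x) ((graphSection hπ hP l.im hξ).im x) :=
    fun hξ x ↦ by simp [IsGraph, graphSection]
  have key : ∀ α β γ : Cot E x, schouten P P x α β γ = schouten π π x α β γ ∧
      schouten P π x α β γ = 0 := by
    intro α β γ
    obtain ⟨ξ, hξ, rfl⟩ := exists_isSmooth_apply_eq (E := E) (F₁ := E →L[ℝ] ℝ) x α
    obtain ⟨η, hη, rfl⟩ := exists_isSmooth_apply_eq (E := E) (F₁ := E →L[ℝ] ℝ) x β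
    have h1 := courant_graph hπ hP hπs hPs him (hgraph hξ) (hgraph hη) x γ
    have h2 := (h.isEigen_iff hre him x _ _).1 (hJ _ _
      (fun x ↦ (h.isEigen_iff hre him x _ _).2 (hgraph hξ x))
      (fun x ↦ (h.isEigen_iff hre him x _ _).2 (hgraph hη x)) x)
    obtain ⟨h3, h4⟩ := h1
    rw [sub_eq_zero.2 h2.1, map_zero] at h3
    rw [sub_eq_zero.2 h2.2, map_zero] at h4
    -- The imaginary covector parts vanish, so only the terms in the two real parts survive.
    simp only [graphSection, schouten_zero_left, schouten_zero_middle, mul_zero, sub_zero,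
      add_zero, zero_add] at h3 h4
    exact ⟨by linarith, (mul_eq_zero.1 h4.symm).resolve_left hl⟩
  exact ⟨by ext α β γ; exact (key α β γ).1, by ext α β γ; exact (key α β γ).2⟩

end Integrability

/-! ### From Hitchin pairs to generalized complex structures, and the blocks of J -/

section Correspondence

variable {E : Type*} [NormedAddCommGroup E] [NormedSpace ℝ E]
  {M : Type*} [TopologicalSpace M] [ChartedSpace E M] [IsManifold 𝓘(ℝ, E) ∞ M]

theorem GCStructure.toMap_apply (J : GCStructure E M) (x : M) (X : Tan E x) (ξ : Cot E x) :
    J.toMap x (X, ξ) = (blockTT J.toMap x X + blockCT J.toMap x ξ,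
      blockTC J.toMap x X + blockCC J.toMap x ξ) := by
  have h : (X, ξ) = (X, 0) + ((0, ξ) : GTan E x) := by simp
  rw [h, map_add]
  rfl

theorem GCStructure.blockTC_skew (J : GCStructure E M) (x : M) (X Y : Tan E x) :
    blockTC J.toMap x X Y = -blockTC J.toMap x Y X := by
  have h := J.skew x (X, 0) (Y, 0)
  simp [pairing, J.toMap_apply] at h
  have aux : ∀ a b : ℝ, 2⁻¹ * a = -(2⁻¹ * b) → a = -b := fun a b h ↦ by linarith
  exact aux _ _ h

theorem GCStructure.blockCC_apply (J : GCStructure E M) (x : M) (α : Cot E x) (Y : Tan E x) :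
    blockCC J.toMap x α Y = -α (blockTT J.toMap x Y) := by
  have h := J.skew x (0, α) (Y, 0)
  simp [pairing, J.toMap_apply] at h
  have aux : ∀ a b : ℝ, 2⁻¹ * a = -(2⁻¹ * b) → a = -b := fun a b h ↦ by linarith
  exact aux _ _ h

variable [FiniteDimensional ℝ E]

theorem isInvertible_of_bijective {V W : Type*} [NormedAddCommGroup V] [NormedSpace ℝ V]
    [CompleteSpace V] [NormedAddCommGroup W] [NormedSpace ℝ W] [CompleteSpace W] {T : V →L[ℝ] W}
    (h : Function.Bijective T) : T.IsInvertible :=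
  ⟨ContinuousLinearEquiv.ofBijective T (LinearMap.ker_eq_bot.2 h.1) (LinearMap.range_eq_top.2 h.2),
    ContinuousLinearEquiv.coe_ofBijective _ _ _⟩

theorem HitchinPair.isInvertible (H : HitchinPair E M) (x : M) :
    (H.Pi.toMap x).IsInvertible :=
  isInvertible_of_bijective (V := E →L[ℝ] ℝ) (W := E) (H.nondegenerate x)

/-- The endomorphism of `T ⊕ T^*` defined by a pair of bivectors. -/
def hitchinMap (π P : ∀ x : M, Cot E x →L[ℝ] Tan E x) (x : M) : GTan E x →L[ℝ] GTan E x :=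
  let A := π x ∘L (P x).inverse
  (A ∘L ContinuousLinearMap.fst ℝ _ _ -
    (P x + A ∘L π x) ∘L ContinuousLinearMap.snd ℝ _ _).prod
  ((P x).inverse ∘L ContinuousLinearMap.fst ℝ _ _ -
    ((P x).inverse ∘L π x) ∘L ContinuousLinearMap.snd ℝ _ _)

theorem HitchinPair.hasHitchinBlocks (H : HitchinPair E M) :
    HasHitchinBlocks (hitchinMap H.pi.toMap H.Pi.toMap) H.pi.toMap H.Pi.toMap where
  isInvertible := H.isInvertible
  apply_eq _ _ _ := rfl

theorem HitchinPair.isSmooth_inverse (H : HitchinPair E M) :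
    IsSmooth E (E →L[ℝ] E →L[ℝ] ℝ) (fun x ↦ (H.Pi.toMap x).inverse) :=
  IsSmooth.inverse H.Pi.smooth (fun x ↦ (H.isInvertible x).self_apply_inverse)
    (fun x ↦ (H.isInvertible x).inverse_apply_self)

/-- The generalized complex structure defined by a Hitchin pair. -/
def HitchinPair.toGCStructure (H : HitchinPair E M) : GCStructure E M where
  toMap := hitchinMap H.pi.toMap H.Pi.toMap
  smoothTT := by
    have h : blockTT (hitchinMap H.pi.toMap H.Pi.toMap) =
        fun x ↦ H.pi.toMap x ∘L (H.Pi.toMap x).inverse := by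
      ext x v
      simp [blockTT, hitchinMap]
    rw [h]
    exact H.pi.smooth.comp H.isSmooth_inverse
  smoothCT := by
    have h : blockCT (hitchinMap H.pi.toMap H.Pi.toMap) = -(H.Pi.toMap +
        fun x ↦ (H.pi.toMap x ∘L (H.Pi.toMap x).inverse) ∘L H.pi.toMap x) := by
      ext x v
      simp [blockCT, hitchinMap]
    rw [h]
    exact (H.Pi.smooth.add_section
      (IsSmooth.comp (H.pi.smooth.comp H.isSmooth_inverse) H.pi.smooth)).neg_section
  smoothTC := by
    have h : blockTC (hitchinMap H.pi.toMap H.Pi.toMap) = fun x ↦ (H.Pi.toMap x).inverse := by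
      ext x v
      simp [blockTC, hitchinMap]
    rw [h]
    exact H.isSmooth_inverse
  smoothCC := by
    have h : blockCC (hitchinMap H.pi.toMap H.Pi.toMap) =
        -(fun x ↦ (H.Pi.toMap x).inverse ∘L H.pi.toMap x) := by
      ext x v
      simp [blockCC, hitchinMap]
    rw [h]
    exact (H.isSmooth_inverse.comp H.pi.smooth).neg_section
  sq_eq x := by
    rintro ⟨X, ξ⟩
    have h := H.hasHitchinBlocks.apply_eq x
    have h1 := (H.isInvertible x).inverse_apply_self
    have h2 := (H.isInvertible x).self_apply_inverse
    simp only [h, map_sub, map_add, h1, h2, Prod.neg_mk]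
    exact Prod.ext (by simp only; abel) (by simp only; abel)
  skew x := by
    rintro ⟨X, ξ⟩ ⟨Y, η⟩
    have h1 := (H.isInvertible x).self_apply_inverse
    have e1 : ∀ X Y, (H.Pi.toMap x).inverse X Y = -(H.Pi.toMap x).inverse Y X := fun X Y ↦ by
      have h := H.Pi.skew x ((H.Pi.toMap x).inverse Y) ((H.Pi.toMap x).inverse X)
      rwa [h1, h1] at h
    -- With A = π Π⁻¹ this says Π⁻¹ π = A^*, because π and Π⁻¹ are both skew.
    have e2 : ∀ α Y, (H.Pi.toMap x).inverse (H.pi.toMap x α) Y =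
        α (H.pi.toMap x ((H.Pi.toMap x).inverse Y)) := fun α Y ↦ by
      rw [e1, H.pi.skew x α, neg_neg]
    simp only [pairing, H.hasHitchinBlocks.apply_eq x, map_sub, map_add]
    change (1 / 2 : ℝ) * ((H.Pi.toMap x).inverse X Y -
      (H.Pi.toMap x).inverse (H.pi.toMap x ξ) Y + _) = -((1 / 2 : ℝ) * (_ +
        ((H.Pi.toMap x).inverse Y X - (H.Pi.toMap x).inverse (H.pi.toMap x η) X)))
    -- Rewritten by `e2`, this is the skewness of π Π⁻¹ π, the second summand of (1 + A²)Π.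
    have e3 := H.pi.skew x ξ ((H.Pi.toMap x).inverse (H.pi.toMap x η))
    rw [e2] at e3
    rw [e2, e2, e1 X Y, H.Pi.skew x ξ η]
    have aux : ∀ a b c d e f : ℝ, e = -f → (1 / 2 : ℝ) * (-a - b + (c - (-d + e))) =
        -((1 / 2 : ℝ) * (b - (d + f) + (a - c))) := by
      rintro a b c d e f rfl
      ring
    exact aux _ _ _ _ _ _ e3
  integrable := by
    constructor <;>
    exact H.hasHitchinBlocks.closedUnderCourant H.pi.smooth H.Pi.smooth H.pi.skew H.Pi.skew
      (by simp) (by simp) H.schouten_eq H.schouten_zero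

/-- The bivector `Π = σ⁻¹` of a generalized complex structure with nondegenerate block `σ`. -/
def sigmaInverse (J : ∀ x : M, GTan E x →L[ℝ] GTan E x) (x : M) : Cot E x →L[ℝ] Tan E x :=
  (blockTC J x).inverse

/-- The bivector `π = A σ⁻¹` of a generalized complex structure with nondegenerate block `σ`. -/
def blockSigmaInverse (J : ∀ x : M, GTan E x →L[ℝ] GTan E x) (x : M) : Cot E x →L[ℝ] Tan E x :=
  blockTT J x ∘L sigmaInverse J x

variable {J : GCStructure E M}

theorem GCStructure.isInvertible (hJ : ∀ x, Function.Bijective (blockTC J.toMap x)) (x : M) :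
    (blockTC J.toMap x).IsInvertible :=
  isInvertible_of_bijective (V := E) (W := E →L[ℝ] ℝ) (hJ x)

/-- On T, the equation J² = -1 reads A² + π_A σ = -1 and σA + Dσ = 0, with D the lower right block.
Since σ is invertible, these determine π_A and D. -/
theorem GCStructure.hasHitchinBlocks (hJ : ∀ x, Function.Bijective (blockTC J.toMap x)) :
    HasHitchinBlocks J.toMap (blockSigmaInverse J.toMap) (sigmaInverse J.toMap) where
  isInvertible x := (isInvertible hJ x).inverse
  apply_eq x X ξ := by
    have h1 := (isInvertible hJ x).self_apply_inverse
    have h2 := (isInvertible hJ x).inverse_apply_self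
    have hsq : ∀ X, (blockTT J.toMap x (blockTT J.toMap x X) +
        blockCT J.toMap x (blockTC J.toMap x X) = -X) ∧
        blockTC J.toMap x (blockTT J.toMap x X) + blockCC J.toMap x (blockTC J.toMap x X) = 0 :=
      fun X ↦ by
        have h := J.sq_eq x (X, 0)
        simpa [J.toMap_apply] using h
    have hCT : blockCT J.toMap x ξ = -((blockTC J.toMap x).inverse ξ) -
        blockTT J.toMap x (blockTT J.toMap x ((blockTC J.toMap x).inverse ξ)) := by
      have h := (hsq ((blockTC J.toMap x).inverse ξ)).1
      rw [h1] at h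
      rw [← h]
      abel
    have hCC : blockCC J.toMap x ξ =
        -blockTC J.toMap x (blockTT J.toMap x ((blockTC J.toMap x).inverse ξ)) := by
      have h := (hsq ((blockTC J.toMap x).inverse ξ)).2
      rw [h1] at h
      exact eq_neg_of_add_eq_zero_right h
    rw [J.toMap_apply, hCT, hCC]
    simp only [sigmaInverse, blockSigmaInverse, (isInvertible hJ x).inverse_inverse,
      ContinuousLinearMap.comp_apply, h2]
    exact Prod.ext (by simp only; abel) (by simp only; abel)

end Correspondence

/-! ### The two constructions are mutually inverse -/

section Bijection

variable {E : Type*} [NormedAddCommGroup E] [NormedSpace ℝ E]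
  {M : Type*} [TopologicalSpace M] [ChartedSpace E M] [IsManifold 𝓘(ℝ, E) ∞ M]

theorem Bivector.ext_toMap {P Q : Bivector E M} (h : P.toMap = Q.toMap) : P = Q := by
  cases P
  cases Q
  congr

theorem HitchinPair.ext_toMap {H K : HitchinPair E M} (h₁ : H.pi.toMap = K.pi.toMap)
    (h₂ : H.Pi.toMap = K.Pi.toMap) : H = K := by
  obtain ⟨p, P, _, _, _⟩ := H
  obtain ⟨q, Q, _, _, _⟩ := K
  obtain rfl : p = q := Bivector.ext_toMap h₁
  obtain rfl : P = Q := Bivector.ext_toMap h₂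
  rfl

theorem GCStructure.ext_toMap {J K : GCStructure E M} (h : J.toMap = K.toMap) : J = K := by
  cases J
  cases K
  congr

variable [FiniteDimensional ℝ E]

theorem HitchinPair.blockTC_toGCStructure (H : HitchinPair E M) (x : M) :
    blockTC H.toGCStructure.toMap x = (H.Pi.toMap x).inverse := by
  ext v
  simp [blockTC, hitchinMap, toGCStructure]

theorem HitchinPair.blockTT_toGCStructure (H : HitchinPair E M) (x : M) :
    blockTT H.toGCStructure.toMap x = H.pi.toMap x ∘L (H.Pi.toMap x).inverse := by
  ext v
  simp [blockTT, hitchinMap, toGCStructure]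

theorem HitchinPair.bijective_blockTC (H : HitchinPair E M) (x : M) :
    Function.Bijective (blockTC H.toGCStructure.toMap x) := by
  rw [H.blockTC_toGCStructure]
  exact (H.isInvertible x).inverse.bijective

theorem HitchinPair.sigmaInverse_toGCStructure (H : HitchinPair E M) :
    sigmaInverse H.toGCStructure.toMap = H.Pi.toMap := by
  funext x
  rw [sigmaInverse, H.blockTC_toGCStructure, (H.isInvertible x).inverse_inverse]

theorem HitchinPair.blockSigmaInverse_toGCStructure (H : HitchinPair E M) :
    blockSigmaInverse H.toGCStructure.toMap = H.pi.toMap := by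
  funext x
  rw [blockSigmaInverse, H.sigmaInverse_toGCStructure, H.blockTT_toGCStructure,
    ContinuousLinearMap.comp_assoc, (H.isInvertible x).inverse_comp_self,
    ContinuousLinearMap.comp_id]

section Nondegenerate

variable {J : GCStructure E M} (hJ : ∀ x, Function.Bijective (blockTC J.toMap x))
include hJ

theorem GCStructure.isSmooth_sigmaInverse :
    IsSmooth E ((E →L[ℝ] ℝ) →L[ℝ] E) (sigmaInverse J.toMap) :=
  IsSmooth.inverse J.smoothTC (fun x ↦ (isInvertible hJ x).self_apply_inverse)
    (fun x ↦ (isInvertible hJ x).inverse_apply_self)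

theorem GCStructure.isSmooth_blockSigmaInverse :
    IsSmooth E ((E →L[ℝ] ℝ) →L[ℝ] E) (blockSigmaInverse J.toMap) :=
  J.smoothTT.comp (isSmooth_sigmaInverse hJ)

theorem GCStructure.sigmaInverse_skew (x : M) (α β : Cot E x) :
    β (sigmaInverse J.toMap x α) = -α (sigmaInverse J.toMap x β) := by
  have h1 := (isInvertible hJ x).self_apply_inverse
  have h := J.blockTC_skew x (sigmaInverse J.toMap x β) (sigmaInverse J.toMap x α)
  simpa only [sigmaInverse, h1] using h

theorem GCStructure.blockCC_eq (x : M) (α : Cot E x) :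
    blockCC J.toMap x α = -blockTC J.toMap x (blockSigmaInverse J.toMap x α) := by
  have h := (hasHitchinBlocks hJ).apply_eq x 0 α
  simpa [J.toMap_apply, sigmaInverse, (isInvertible hJ x).inverse_inverse] using congrArg Prod.snd h

/-- The lower right block is -A^* because J is skew, and -σπ because J² = -1. Hence σπ = A^*, and
skewness of σ turns this into skewness of π. -/
theorem GCStructure.blockSigmaInverse_skew (x : M) (α β : Cot E x) :
    β (blockSigmaInverse J.toMap x α) = -α (blockSigmaInverse J.toMap x β) := by
  have h1 := (isInvertible hJ x).self_apply_inverse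
  have h2 := J.blockCC_apply x β (sigmaInverse J.toMap x α)
  have h3 := J.blockTC_skew x (blockSigmaInverse J.toMap x β) (sigmaInverse J.toMap x α)
  have h4 : blockTC J.toMap x (sigmaInverse J.toMap x α) = α := h1 α
  have h5 := DFunLike.congr_fun (blockCC_eq hJ x β) (sigmaInverse J.toMap x α)
  rw [h4] at h3
  have aux : ∀ a b c d : ℝ, a = -b → c = -d → a = -c → b = -d := by
    intros
    linarith
  exact aux _ _ _ _ h2 h3 h5

/-- The Hitchin pair of a generalized complex structure with nondegenerate block `σ`. -/
def GCStructure.toHitchinPair [T2Space M] : HitchinPair E M where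
  pi := ⟨blockSigmaInverse J.toMap, blockSigmaInverse_skew hJ, isSmooth_blockSigmaInverse hJ⟩
  Pi := ⟨sigmaInverse J.toMap, sigmaInverse_skew hJ, isSmooth_sigmaInverse hJ⟩
  nondegenerate x := (isInvertible hJ x).inverse.bijective
  schouten_eq x := ((hasHitchinBlocks hJ).schouten_eq (isSmooth_blockSigmaInverse hJ)
    (isSmooth_sigmaInverse hJ) (blockSigmaInverse_skew hJ) (sigmaInverse_skew hJ)
    (l := Complex.I) (by simp) (by simp) J.integrable.1 x).1
  schouten_zero x := ((hasHitchinBlocks hJ).schouten_eq (isSmooth_blockSigmaInverse hJ)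
    (isSmooth_sigmaInverse hJ) (blockSigmaInverse_skew hJ) (sigmaInverse_skew hJ)
    (l := Complex.I) (by simp) (by simp) J.integrable.1 x).2

/-- J is determined by its pair of bivectors; this is the left inverse law of the correspondence. -/
theorem GCStructure.hitchinMap_eq :
    hitchinMap (blockSigmaInverse J.toMap) (sigmaInverse J.toMap) = J.toMap := by
  funext x
  refine ContinuousLinearMap.ext fun ⟨X, ξ⟩ ↦ ?_
  rw [(hasHitchinBlocks hJ).apply_eq]
  rfl

theorem GCStructure.blockSigmaInverse_comp_blockTC (x : M) :
    blockSigmaInverse J.toMap x ∘L blockTC J.toMap x = blockTT J.toMap x := by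
  rw [blockSigmaInverse, sigmaInverse, ContinuousLinearMap.comp_assoc,
    (isInvertible hJ x).inverse_comp_self, ContinuousLinearMap.comp_id]

theorem GCStructure.blockCT_eq (x : M) : blockCT J.toMap x =
    -((.id ℝ _ + blockTT J.toMap x ∘L blockTT J.toMap x) ∘L sigmaInverse J.toMap x) := by
  ext ξ
  have h := congrArg Prod.fst ((hasHitchinBlocks hJ).apply_eq x 0 ξ)
  have hinv : (sigmaInverse J.toMap x).inverse = blockTC J.toMap x :=
    (isInvertible hJ x).inverse_inverse
  have hA : ∀ X, blockSigmaInverse J.toMap x (blockTC J.toMap x X) = blockTT J.toMap x X := fun X ↦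
    DFunLike.congr_fun (blockSigmaInverse_comp_blockTC hJ x) X
  simp only [J.toMap_apply, map_zero, zero_add, zero_sub, hinv, hA] at h
  exact h

end Nondegenerate

/-- Generalized complex structures with nondegenerate block `σ` correspond to Hitchin pairs. -/
def hitchinEquiv [T2Space M] :
    {J : GCStructure E M // ∀ x, Function.Bijective (blockTC J.toMap x)} ≃ HitchinPair E M where
  toFun J := GCStructure.toHitchinPair J.2
  invFun H := ⟨H.toGCStructure, H.bijective_blockTC⟩
  left_inv J := Subtype.ext (GCStructure.ext_toMap (GCStructure.hitchinMap_eq J.2))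
  right_inv H := HitchinPair.ext_toMap H.blockSigmaInverse_toGCStructure H.sigmaInverse_toGCStructure

end Bijection

end GenComplex

end
theorem mainTheorem6 {E : Type*} [NormedAddCommGroup E] [NormedSpace ℝ E]
    [FiniteDimensional ℝ E] {M : Type*} [TopologicalSpace M] [T2Space M] [ChartedSpace E M]
    [IsManifold 𝓘(ℝ, E) ∞ M] :
    ∃ e : {J : GenComplex.GCStructure E M //
          ∀ x, Function.Bijective (GenComplex.blockTC J.toMap x)} ≃ GenComplex.HitchinPair E M,
      ∀ (J : {J : GenComplex.GCStructure E M //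
          ∀ x, Function.Bijective (GenComplex.blockTC J.toMap x)}) (x : M),
        let A := GenComplex.blockTT J.1.toMap x
        let piA := GenComplex.blockCT J.1.toMap x
        let σ := GenComplex.blockTC J.1.toMap x
        let π := (e J).pi.toMap x
        let P := (e J).Pi.toMap x
        -- the lower right block is `-A^*`
        (∀ α, GenComplex.blockCC J.1.toMap x α = -(α ∘L A)) ∧
        -- `σ` is the inverse of `Π`
        σ ∘L P = .id ℝ _ ∧ P ∘L σ = .id ℝ _ ∧
        -- `A = π Π⁻¹` and `π_A = -(1 + A²) Π`
        A = π ∘L P.inverse ∧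
        piA = -((.id ℝ _ + A ∘L A) ∘L P) := by

  refine ⟨GenComplex.hitchinEquiv, fun J x ↦ ⟨fun α ↦ ?_, ?_, ?_, ?_, ?_⟩⟩
  · ext Y
    exact J.1.blockCC_apply x α Y
  · exact (GenComplex.GCStructure.isInvertible J.2 x).self_comp_inverse
  · exact (GenComplex.GCStructure.isInvertible J.2 x).inverse_comp_self
  · change _ = GenComplex.blockSigmaInverse J.1.toMap x ∘L (GenComplex.sigmaInverse J.1.toMap x).inverse
    rw [GenComplex.sigmaInverse, (GenComplex.GCStructure.isInvertible J.2 x).inverse_inverse,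
      GenComplex.GCStructure.blockSigmaInverse_comp_blockTC J.2]
  · exact GenComplex.GCStructure.blockCT_eq J.2 x
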